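/- **Setting.** Let $D$ be a planar link diagram with numbered crossings. A Kauffman state $s$ labels each crossing $A$ or $B$; smoothing accordingly gives a set $sD$ of disjoint circles, with a scar at each crossing (blue for $A$, red for $B$). An enhanced state also assigns a sign $\pm$ to each circle. Its degrees are $i=\#\{B\text{-labels}\}$ and $j=i+\#\{+\text{ circles}\}-\#\{-\text{ circles}\}$. Let $C(D)$ be the free abelian group on the enhanced states, with Viro's differential $d(S)=\sum_T i(S,T)\,T$. Here $i(S,T)=(-1)^m$ if $T$ is obtained by changing one label $A$ to $B$ at a crossing $x$, $j(T)=j(S)$, and the signs agree on all circles common to $S$ and $T$; $m$ is the number of $B$-labels of $S$ at crossings before $x$. Otherwise $i(S,T)=0$. Let $\underline{Kh}(D)=\ker d/\operatorname{im} d=\bigoplus_{i,j}\underline{Kh}^{i,j}(D)$. A (blue) ladder of height $h\ge 1$ of $sD$ is a maximal disc containing exactly two arcs of $sD$ and $h$ parallel blue scars (its steps) joining them. Cutting all the ladders and joining, for each ladder, the two extremes on each of its two sides, each ladder is touched by one or two circles; their number is its periphery number. A scar is a bichord if it joins two different circles. Let $s_0$ be a Kauffman state such that all the blue scars of $s_0D$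 are grouped into $k$ ladders $H_1,\dots,H_k$ of heights $h_1,\dots,h_k\ge 2$. Number the crossings so that those of $H_1$ come first, in the order of its steps, then those of $H_2$, and so on, and finally the remaining ones. Assume: 1. every ladder has periphery number one; 2. some ladder has height at least $3$; 3. every red scar of $s_0D$ is a bichord in $s_1D$, where $s_1$ is obtained from $s_0$ by changing to red one blue step of each ladder. Call $\mu\in\mathbb Z^k$ admissible if $2\le\mu_t\le h_t$ for all $t$ and some $\mu_r$ is even with $\mu_r<h_r$. For $\eta\in\mathbb Z^k$ with $0<\eta_t\le h_t$ let $s(\eta;C_i^{0-})$ be the sum of all the enhanced states obtained from $s_0$ by changing $\eta_t$ steps of each $H_t$ to red and giving sign $+$ to all circles except the periphery circle $C_i^0$ touching the first red scar of $H_i$, which gets sign $-$. Put $$V(\mu)=\sum_{i:\ \mu_i\text{ even},\ \mu_i<h_i}(-1)^{\mu_1+\dots+\mu_{i-1}}\,s(\mu_1,\dots,\mu_{i-1},\mu_i+1,\mu_{i+1},\dots,\mu_k;\,C_i^{0-}).$$ **Theorem.** Let $\mu\neq\mu'$ be admissible. Then $V(\mu)$ and $V(\mu')$ are cycles. Consider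 the condition $(\ast)$: * (i) $\sum_t\mu_t=\sum_t\mu'_t$, and there exist $t_1,t_2\in\{1,\dots,k\}$ such that * (ii) $\mu_{t_1}\ne\mu'_{t_1}$, $\mu_{t_2}\ne\mu'_{t_2}$, and $\mu_t=\mu'_t$ for all $t\ne t_1,t_2$; * (iii) for all $t\ne t_1,t_2$, $\mu_t$ is odd or equal to $h_t$; * (iv) $\mu_{t_1}$ is even, $\mu_{t_1}<h_{t_1}$, $\mu_{t_2}$ is odd, and $(\mu'_{t_1},\mu'_{t_2})=(\mu_{t_1}+1,\mu_{t_2}-1)$. If $[V(\mu)]=[V(\mu')]$ in $\underline{Kh}(D)$, then $(\ast)$ holds. Conversely, if $(\ast)$ holds and the ladders at whose indices $\mu$ and $\mu'$ differ lie in the same connected component of the diagram $D$, then $[V(\mu)]=[V(\mu')]$. In particular, if $D$ is a connected diagram, then $[V(\mu)]=[V(\mu')]$ if and only if $(\ast)$ holds. -/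

import Mathlib

open scoped BigOperators

/-! ### Link diagrams -/

/-- The four edge ends at each of `n` crossings. At a crossing `x`, the ends `(x, 0)`, `(x, 1)`,
`(x, 2)`, `(x, 3)` are listed counterclockwise; `(x, 0)` and `(x, 2)` are the ends of the
under-strand, `(x, 1)` and `(x, 3)` those of the over-strand. -/
abbrev CrossingEnd (n : ℕ) : Type := Fin n × Fin 4

/-- The counterclockwise rotation around each crossing. -/
def rotateEnds (n : ℕ) : Equiv.Perm (CrossingEnd n) :=
  Equiv.prodCongr (Equiv.refl (Fin n)) (Equiv.addRight (1 : Fin 4))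

/-- The faces of the 4-valent graph whose edges are the 2-cycles of `edge`: going along an edge
and then turning to the neighbouring end traverses the boundary of a face. -/
abbrev DiagramFace {n : ℕ} (edge : Equiv.Perm (CrossingEnd n)) : Type :=
  Quotient (Equiv.Perm.SameCycle.setoid (rotateEnds n * edge))

/-- Two crossing ends lie in the same connected component of the 4-valent graph. -/
def diagramComponentSetoid {n : ℕ} (edge : Equiv.Perm (CrossingEnd n)) :
    Setoid (CrossingEnd n) :=
  Relation.EqvGen.setoid fun a b => b = edge a ∨ b.1 = a.1

/-- A (planar) link diagram: a 4-valent graph with over/under information on the sphere, encoded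
by its rotation system, together with a number of circles without crossings. The ends at the
crossings are matched into edges by the fixed-point free involution `edge`. Planarity is Euler's
formula `V - E + F = 2 C` with `V = n` crossings, `E = 2 n` edges, `F` faces and `C` connected
components (each component has Euler characteristic at most `2`, so every component has genus
zero). The crossings are numbered, as in the definition of the Khovanov complex. -/
structure LinkDiagram where
  /-- the number of crossings -/
  n : ℕ
  /-- the number of components of the diagram without any crossing -/
  loops : ℕ
  edge : Equiv.Perm (CrossingEnd n)
  edge_edge : ∀ a, edge (edge a) = a
  edge_ne : ∀ a, edge a ≠ a
  planar : Nat.card (DiagramFace edge) =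
    n + 2 * Nat.card (Quotient (diagramComponentSetoid edge))

/-- The two labels of crossings in a Kauffman state. -/
inductive SmoothingLabel : Type
  | A
  | B
  deriving DecidableEq

instance : Fintype SmoothingLabel :=
  ⟨{SmoothingLabel.A, SmoothingLabel.B}, fun l => by cases l <;> simp⟩

namespace LinkDiagram

/-! ### Kauffman states and enhanced states -/

/-- Kauffman states. -/
abbrev KState (D : LinkDiagram) : Type := Fin D.n → SmoothingLabel

/-- The points used to describe circles: the crossing ends, and one point for each circle
without crossings. -/
abbrev Pt (D : LinkDiagram) : Type := CrossingEnd D.n ⊕ Fin D.loops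

/-- The smoothing of the crossings according to the labels: the `A`-smoothing (which joins the two
regions swept when the over-strand turns counterclockwise) connects the ends `0, 1` and the ends
`2, 3`; the `B`-smoothing connects the ends `1, 2` and the ends `3, 0`. -/
def smooth (D : LinkDiagram) (s : D.KState) (a : CrossingEnd D.n) : CrossingEnd D.n :=
  match s a.1 with
  | SmoothingLabel.A => (a.1, ![1, 0, 3, 2] a.2)
  | SmoothingLabel.B => (a.1, ![3, 2, 1, 0] a.2)

/-- Two points are directly joined in `sD`, by an edge or by an arc at a smoothed crossing. -/
inductive Joined (D : LinkDiagram) (s : D.KState) : D.Pt → D.Pt → Prop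
  | edge (a : CrossingEnd D.n) : Joined D s (Sum.inl a) (Sum.inl (D.edge a))
  | arc (a : CrossingEnd D.n) : Joined D s (Sum.inl a) (Sum.inl (D.smooth s a))

/-- Lying on the same circle of `sD`. -/
def circleSetoid (D : LinkDiagram) (s : D.KState) : Setoid D.Pt :=
  Relation.EqvGen.setoid (D.Joined s)

/-- The circles of `sD`. -/
abbrev Circle (D : LinkDiagram) (s : D.KState) : Type := Quotient (D.circleSetoid s)

/-- The circle of `sD` through the end `i` at the crossing `x`. -/
def circleAt (D : LinkDiagram) (s : D.KState) (x : Fin D.n) (i : Fin 4) : D.Circle s :=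
  Quotient.mk (D.circleSetoid s) (Sum.inl (x, i))

/-- The scar at the crossing `x` joins two different circles of `sD`. For both labels, the ends
`1` and `3` belong to the two different arcs joined by the scar. -/
def IsBichord (D : LinkDiagram) (s : D.KState) (x : Fin D.n) : Prop :=
  D.circleAt s x 1 ≠ D.circleAt s x 3

/-- Enhanced states: a Kauffman state with a sign `1` or `-1` on each circle. -/
abbrev EState (D : LinkDiagram) : Type := Σ s : D.KState, (D.Circle s → ℤˣ)

noncomputable instance (D : LinkDiagram) (s : D.KState) : Fintype (D.Circle s) :=
  Fintype.ofFinite _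

noncomputable instance (D : LinkDiagram) : Fintype D.EState := Fintype.ofFinite _

/-- The homological degree `i(S)`: the number of `B`-labels. -/
def hdeg {D : LinkDiagram} (S : D.EState) : ℤ :=
  ((Finset.univ.filter fun x => S.1 x = SmoothingLabel.B).card : ℤ)

/-- `θ(S)`: the number of positive circles minus the number of negative circles. -/
noncomputable def theta {D : LinkDiagram} (S : D.EState) : ℤ :=
  ∑ c : D.Circle S.1, ((S.2 c : ℤˣ) : ℤ)

/-- The quantum degree `j(S) = i(S) + θ(S)`. -/
noncomputable def qdeg {D : LinkDiagram} (S : D.EState) : ℤ := hdeg S + theta S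

/-- `T` is adjacent to `S` with change crossing `x`. -/
def AdjacentAt {D : LinkDiagram} (x : Fin D.n) (S T : D.EState) : Prop :=
  hdeg T = hdeg S + 1 ∧ qdeg T = qdeg S ∧
  S.1 x = SmoothingLabel.A ∧ T.1 x = SmoothingLabel.B ∧ (∀ y, y ≠ x → T.1 y = S.1 y) ∧
  -- the signs agree on every circle that is common to the two states
  ∀ p : D.Pt, (∀ q, D.circleSetoid S.1 p q ↔ D.circleSetoid T.1 p q) →
    S.2 (Quotient.mk (D.circleSetoid S.1) p) = T.2 (Quotient.mk (D.circleSetoid T.1) p)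

open Classical in
/-- The incidence number of `S` over `T` (there is at most one change crossing). -/
noncomputable def incidence {D : LinkDiagram} (S T : D.EState) : ℤ :=
  ∑ x : Fin D.n, if AdjacentAt x S T then
    (-1) ^ (Finset.univ.filter fun y => y < x ∧ S.1 y = SmoothingLabel.B).card else 0

/-! ### Khovanov homology -/

/-- The chains `C(D)`, the direct sum of all the `C^{i,j}(D)`, with integer coefficients. -/
abbrev Chain (D : LinkDiagram) : Type := D.EState →₀ ℤ

/-- The Khovanov differential (it maps `C^{i,j}(D)` to `C^{i+1,j}(D)`). -/
noncomputable def d (D : LinkDiagram) : D.Chain →ₗ[ℤ] D.Chain :=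
  Finsupp.linearCombination ℤ fun S => ∑ T : D.EState, Finsupp.single T (incidence S T)

/-- The Khovanov homology `ker d / im d` of the diagram, in all bidegrees together: the direct sum
of all the `Kh^{i,j}(D)`. -/
abbrev Kh (D : LinkDiagram) : Type :=
  ↥(LinearMap.ker D.d) ⧸ (LinearMap.range D.d).submoduleOf (LinearMap.ker D.d)

/-- The homology class of a cycle. -/
noncomputable def homologyClass (D : LinkDiagram) (Z : D.Chain) (hZ : Z ∈ LinearMap.ker D.d) : D.Kh :=
  Submodule.Quotient.mk ⟨Z, hZ⟩

/-! ### Ladders -/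

/-- In an `A`-smoothed crossing `x` the scar has two sides, the ends `{1, 2}` and the ends `{3, 0}`;
the side `u` (with `u = 1` or `u = 3`) consists of the ends `u, u + 1`. `FacesNext x u y v` says
that two edges connect the side `u` of `x` with the side `v + 2` of `y` and bound a face of the
diagram together with these two crossings: the scars of `x` and `y` are parallel neighbours, `y`
comes after `x` in the direction `u` of `x`, which continues as the direction `v` of `y`. -/
def FacesNext (D : LinkDiagram) (x : Fin D.n) (u : Fin 4) (y : Fin D.n) (v : Fin 4) : Prop :=
  D.edge (x, u) = (y, v + 3) ∧ D.edge (x, u + 1) = (y, v + 2)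

/-- The blue scars of `s₀D` are grouped into `k` ladders of heights `h i ≥ 1`, and the crossings
are ordered according to them. The `a`-th step of the `i`-th ladder is the crossing `step i a`,
and `dir i a` is the side of its scar that looks towards the following steps. -/
structure LadderSystem (D : LinkDiagram) (s₀ : D.KState) {k : ℕ} (h : Fin k → ℕ) where
  height_pos : ∀ i, 0 < h i
  step : (i : Fin k) → Fin (h i) → Fin D.n
  dir : (i : Fin k) → Fin (h i) → Fin 4
  dir_eq : ∀ i a, dir i a = 1 ∨ dir i a = 3
  /-- all steps are blue -/
  step_blue : ∀ i a, s₀ (step i a) = SmoothingLabel.A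
  /-- every blue scar is a step of a ladder -/
  exists_step : ∀ x, s₀ x = SmoothingLabel.A → ∃ i a, step i a = x
  /-- consecutive steps are parallel, with nothing between them -/
  parallel : ∀ i (a b : Fin (h i)), (a : ℕ) + 1 = b →
    D.FacesNext (step i a) (dir i a) (step i b) (dir i b)
  /-- ladders are maximal: no further blue scar can be added after the last step -/
  maximal_last : ∀ i (a : Fin (h i)), (a : ℕ) + 1 = h i → ∀ y v, (v = 1 ∨ v = 3) →
    s₀ y = SmoothingLabel.A → D.FacesNext (step i a) (dir i a) y v → ∃ b, step i b = y
  /-- ladders are maximal: no further blue scar can be added before the first step -/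
  maximal_first : ∀ i (a : Fin (h i)), (a : ℕ) = 0 → ∀ y v, (v = 1 ∨ v = 3) →
    s₀ y = SmoothingLabel.A → D.FacesNext y v (step i a) (dir i a) → ∃ b, step i b = y
  /-- the crossings of each ladder are ordered like its steps -/
  order_steps : ∀ i (a b : Fin (h i)), a < b → step i a < step i b
  /-- the crossings of a ladder precede those of the following ladders -/
  order_ladders : ∀ i j, i < j → ∀ a b, step i a < step j b
  /-- the remaining crossings come last -/
  order_rest : ∀ x, s₀ x = SmoothingLabel.B → ∀ i a, step i a < x

namespace LadderSystem

variable {D : LinkDiagram} {s₀ : D.KState} {k : ℕ} {h : Fin k → ℕ}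

/-- The first step of the `i`-th ladder. -/
def first (H : LadderSystem D s₀ h) (i : Fin k) : Fin D.n := H.step i ⟨0, H.height_pos i⟩

/-- The direction of the first step, pointing into the ladder. -/
def firstDir (H : LadderSystem D s₀ h) (i : Fin k) : Fin 4 := H.dir i ⟨0, H.height_pos i⟩

open Classical in
/-- The Kauffman state `s(M₁, …, M_k)`: in each ladder, the steps in `M i` are changed to red. -/
noncomputable def stateOf (H : LadderSystem D s₀ h) (M : (i : Fin k) → Finset (Fin (h i))) :
    D.KState :=
  fun x => if ∃ i, ∃ a ∈ M i, H.step i a = x then SmoothingLabel.B else s₀ x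

/-- The state `s₁`, obtained by changing one blue step of each ladder (its first one) to red. The
circles of `s₁D` are the circles obtained by cutting all the ladders: the two extremes of the
ladder before its red scar are joined, and so are the two extremes after it. -/
noncomputable def brokenState (H : LadderSystem D s₀ h) : D.KState :=
  H.stateOf fun i => {⟨0, H.height_pos i⟩}

/-- The periphery of the `i`-th ladder: the circles that touch it at its two extremes when all the
ladders are cut. -/
def periphery (H : LadderSystem D s₀ h) (i : Fin k) : Set (D.Circle H.brokenState) :=
  {D.circleAt H.brokenState (H.first i) (H.firstDir i + 2),
    D.circleAt H.brokenState (H.first i) (H.firstDir i)}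

/-- The periphery number of the `i`-th ladder, one or two. -/
noncomputable def peripheryNumber (H : LadderSystem D s₀ h) (i : Fin k) : ℕ :=
  (H.periphery i).ncard

/-- The circle `C_i^0` of a state `s(M₁, …, M_k)`: the circle touching the first red scar of the
ladder from outside. It runs along both arcs of the ladder up to that scar, so it is the circle
through the extremes of the ladder before its first step. -/
def outerCircle (H : LadderSystem D s₀ h) (s : D.KState) (i : Fin k) : D.Circle s :=
  D.circleAt s (H.first i) (H.firstDir i + 2)

open Classical in
/-- The chain `s(η₁, …, η_k; C_i^{0-})`: the sum of all `s(M₁, …, M_k)` with `η j` red steps in the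
`j`-th ladder, with all circles signed `+` except `C_i^0`. -/
noncomputable def minusChain (H : LadderSystem D s₀ h) (η : Fin k → ℕ) (i : Fin k) : D.Chain :=
  ∑ M ∈ Finset.univ.filter
      (fun M : (j : Fin k) → Finset (Fin (h j)) => ∀ j, (M j).card = η j),
    Finsupp.single
      (⟨H.stateOf M, fun c => if c = H.outerCircle (H.stateOf M) i then -1 else 1⟩ : D.EState) 1

/-- The chain `V(μ₁, …, μ_k)`. -/
noncomputable def V (H : LadderSystem D s₀ h) (μ : Fin k → ℕ) : D.Chain :=
  ∑ i ∈ Finset.univ.filter (fun i => Even (μ i) ∧ μ i < h i),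
    (-1 : ℤ) ^ (∑ j ∈ Finset.univ.filter (fun j => j < i), μ j) •
      H.minusChain (Function.update μ i (μ i + 1)) i

/-- Two ladders lie in the same connected component of the diagram. -/
def SameComponent (H : LadderSystem D s₀ h) (i j : Fin k) : Prop :=
  diagramComponentSetoid D.edge (H.first i, 0) (H.first j, 0)

end LadderSystem

end LinkDiagram

/-- Admissible tuples: `2 ≤ μ i ≤ h i` for all `i`, and some `μ r` is even and below `h r`. -/
def AdmissibleTuple {k : ℕ} (h μ : Fin k → ℕ) : Prop :=
  (∀ i, 2 ≤ μ i ∧ μ i ≤ h i) ∧ ∃ r, Even (μ r) ∧ μ r < h r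

/-- The numerical relation between two tuples. -/
def ExceptionalPair {k : ℕ} (h μ μ' : Fin k → ℕ) : Prop :=
  ∑ t, μ t = ∑ t, μ' t ∧
  ∃ t₁ t₂ : Fin k,
    (μ t₁ ≠ μ' t₁ ∧ μ t₂ ≠ μ' t₂ ∧ ∀ t, t ≠ t₁ → t ≠ t₂ → μ t = μ' t) ∧
    (∀ t, t ≠ t₁ → t ≠ t₂ → Odd (μ t) ∨ μ t = h t) ∧
    (Even (μ t₁) ∧ μ t₁ < h t₁ ∧ Odd (μ t₂) ∧ μ' t₁ = μ t₁ + 1 ∧ μ' t₂ = μ t₂ - 1)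

/-! ### Smoothings and the circles they generate -/

namespace LinkDiagram

variable {D : LinkDiagram}

/-! If a blue label is changed and the new red scar is a bichord, one circle has split into two. A
positive circle gives two terms, one for each half made negative; a negative circle gives one term
with both halves negative. In a ladder that already has a red step, every further change is of this
kind (`isBichord_of_two_red`).

Sum over all choices of steps with prescribed numbers η of red steps. The part of the differential
coming from the ladder t is then, over each resulting state, an alternating sum over the red steps
of t. Consecutive red scars face a common circle, so the sum telescopes to the two outer circles of
the ladder. Periphery number one makes these coincide, which leaves the factor 1 + (-1)^(η t)
(`IsFamily.sum_ladder`, `IsFamily.d_sum`). Applied to all-positive states this shows that 2V(μ) is a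
boundary; applied to V(μ) it gives a double sum antisymmetric in the pair of ladders, so V(μ) is a
cycle.

To separate classes, fix a Kauffman state all of whose red scars are bichords and count mod 2 the
terms over it with exactly one negative circle. Boundaries have even count, since a split gives
either two terms with equally many negative circles or one term with at least two
(`oneMinusParity_d`). Red scars off the ladders are bichords because the circles of every state
considered lie inside those of the broken state. Hence every multi-index in V(μ) occurs in V(μ'),
and arithmetic on the tuples forces the exceptional relation.

Conversely, for an exceptional pair both cycles are, up to sign, single chains with the same η and
the negative circle at t₁ or at t₂. Making a red scar off the ladders blue again and taking the
boundary of all-positive states moves the negative circle across that scar, up to sign: the ladders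
contribute nothing, as each η t is odd or maximal. Connectedness carries it from one ladder to the
other, and the sign is harmless because the class of V(μ) is killed by 2. -/

theorem smooth_fst (s : D.KState) (a : CrossingEnd D.n) : (D.smooth s a).1 = a.1 := by
  unfold smooth; cases s a.1 <;> rfl

theorem smooth_of_A {s : D.KState} {a : CrossingEnd D.n} (h : s a.1 = .A) :
    D.smooth s a = (a.1, ![1, 0, 3, 2] a.2) := by
  unfold smooth; rw [h]

theorem smooth_of_B {s : D.KState} {a : CrossingEnd D.n} (h : s a.1 = .B) :
    D.smooth s a = (a.1, ![3, 2, 1, 0] a.2) := by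
  unfold smooth; rw [h]

theorem smooth_smooth (s : D.KState) (a : CrossingEnd D.n) : D.smooth s (D.smooth s a) = a := by
  obtain ⟨x, i⟩ := a
  cases h : s x
  · rw [smooth_of_A (by rw [smooth_fst]; exact h), smooth_of_A h]
    fin_cases i <;> rfl
  · rw [smooth_of_B (by rw [smooth_fst]; exact h), smooth_of_B h]
    fin_cases i <;> rfl

theorem smooth_ne (s : D.KState) (a : CrossingEnd D.n) : D.smooth s a ≠ a := by
  obtain ⟨x, i⟩ := a
  cases h : s x
  · rw [smooth_of_A h]
    fin_cases i <;> simp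
  · rw [smooth_of_B h]
    fin_cases i <;> simp

theorem smooth_congr {s t : D.KState} {a : CrossingEnd D.n} (h : s a.1 = t a.1) :
    D.smooth s a = D.smooth t a := by
  unfold smooth; rw [h]

theorem circleSetoid_edge (s : D.KState) (a : CrossingEnd D.n) :
    D.circleSetoid s (Sum.inl a) (Sum.inl (D.edge a)) :=
  Relation.EqvGen.rel _ _ (Joined.edge a)

theorem circleSetoid_smooth (s : D.KState) (a : CrossingEnd D.n) :
    D.circleSetoid s (Sum.inl a) (Sum.inl (D.smooth s a)) :=
  Relation.EqvGen.rel _ _ (Joined.arc a)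

theorem circleSetoid_le {s : D.KState} {R : Setoid D.Pt}
    (he : ∀ a, R (Sum.inl a) (Sum.inl (D.edge a)))
    (hs : ∀ a, R (Sum.inl a) (Sum.inl (D.smooth s a))) : D.circleSetoid s ≤ R := by
  refine Setoid.eqvGen_le ?_
  rintro _ _ (a | a)
  exacts [he a, hs a]

/-- A set of crossing ends closed under edges and arcs separates circles. -/
theorem not_circleSetoid_of_closed {s : D.KState} (K : Set (CrossingEnd D.n))
    (he : ∀ a ∈ K, D.edge a ∈ K) (hs : ∀ a ∈ K, D.smooth s a ∈ K) {a b : CrossingEnd D.n}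
    (ha : a ∈ K) (hb : b ∉ K) : ¬ D.circleSetoid s (Sum.inl a) (Sum.inl b) := by
  intro hab
  have hle : D.circleSetoid s ≤ Setoid.ker (fun p : D.Pt => ∃ c ∈ K, p = Sum.inl c) := by
    refine circleSetoid_le (fun c => ?_) (fun c => ?_) <;>
      simp only [Setoid.ker_def, Sum.inl.injEq, exists_eq_right', eq_iff_iff]
    · refine ⟨he c, fun h => ?_⟩
      have := he _ h
      rwa [D.edge_edge] at this
    · refine ⟨hs c, fun h => ?_⟩
      have := hs _ h
      rwa [smooth_smooth] at this
  have := hle hab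
  simp only [Setoid.ker_def, Sum.inl.injEq, exists_eq_right', eq_iff_iff] at this
  exact hb (this.1 ha)

theorem even_card_of_involution {α : Type*} [DecidableEq α] (K : Finset α) (f : α → α)
    (hf : ∀ a ∈ K, f a ∈ K) (hff : ∀ a, f (f a) = a) (hne : ∀ a, f a ≠ a) : Even K.card := by
  have h : ∑ _a ∈ K, (1 : ZMod 2) = 0 :=
    Finset.sum_involution (fun a _ => f a) (fun _ _ => by decide) (fun a _ _ => hne a)
      (fun a ha => hf a ha) (fun a _ => hff a)
  rw [Finset.sum_const, nsmul_eq_mul, mul_one] at h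
  exact (ZMod.natCast_eq_zero_iff_even).1 h

/-- The two ends of a side of a `B`-smoothed bichord stay connected when both arcs at the
crossing are removed. -/
theorem side_connected {s s' : D.KState} {x : Fin D.n} (hs : ∀ y, y ≠ x → s y = s' y)
    (hx' : s' x = .B) (hb : D.IsBichord s' x) {u : Fin 4} (hu : u = 1 ∨ u = 3) :
    D.circleSetoid s (Sum.inl (x, u)) (Sum.inl (x, u + 1)) := by
  classical
  -- The relation of lying on one strand after both arcs at `x` are deleted; it refines the circles
  -- of both states.
  let r : CrossingEnd D.n → CrossingEnd D.n → Prop :=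
    fun a b => b = D.edge a ∨ (a.1 ≠ x ∧ b = D.smooth s a)
  let R : Setoid (CrossingEnd D.n) := Relation.EqvGen.setoid r
  have hRe : ∀ a, R a (D.edge a) := fun a => Relation.EqvGen.rel _ _ (Or.inl rfl)
  have hRs : ∀ a : CrossingEnd D.n, a.1 ≠ x → R a (D.smooth s a) :=
    fun a ha => Relation.EqvGen.rel _ _ (Or.inr ⟨ha, rfl⟩)
  have hle : ∀ t : D.KState, (∀ y, y ≠ x → s y = t y) →
      R ≤ (D.circleSetoid t).comap Sum.inl := by
    intro t ht
    refine Setoid.eqvGen_le ?_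
    rintro a b (rfl | ⟨ha, rfl⟩)
    · exact circleSetoid_edge t a
    · have := circleSetoid_smooth t a
      rwa [← smooth_congr (ht _ ha)] at this
  have h13 : ¬ D.circleSetoid s' (Sum.inl (x, 1)) (Sum.inl (x, 3)) :=
    fun h => hb (Quotient.sound h)
  have h12 : D.circleSetoid s' (Sum.inl (x, 1)) (Sum.inl (x, 2)) := by
    have := circleSetoid_smooth s' (x, 1)
    rwa [smooth_of_B hx'] at this
  have h30 : D.circleSetoid s' (Sum.inl (x, 3)) (Sum.inl (x, 0)) := by
    have := circleSetoid_smooth s' (x, 3)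
    rwa [smooth_of_B hx'] at this
  have tr := fun {a b c} => (D.circleSetoid s').trans' (x := a) (y := b) (z := c)
  have sy := fun {a b} => (D.circleSetoid s').symm' (x := a) (y := b)
  suffices hK : R (x, u) (x, u + 1) from hle s (fun _ _ => rfl) hK
  by_contra hcon
  let K : Finset (CrossingEnd D.n) := Finset.univ.filter fun a => R (x, u) a
  have hmem : ∀ a, a ∈ K ↔ R (x, u) a := by simp [K]
  -- The strand cannot reach the other side, since the scar is a bichord in `s'`, nor `u + 1`, by
  -- assumption.
  have hKx : ∀ i, (x, i) ∈ K → i = u := by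
    intro i hi
    rw [hmem] at hi
    by_contra hne
    have hi' : D.circleSetoid s' (Sum.inl (x, u)) (Sum.inl (x, i)) := hle s' hs hi
    rcases hu with rfl | rfl
    · fin_cases i
      · exact h13 (tr hi' (sy h30))
      · exact hne rfl
      · exact hcon hi
      · exact h13 hi'
    · fin_cases i
      · exact hcon hi
      · exact h13 (sy hi')
      · exact h13 (tr h12 (sy hi'))
      · exact hne rfl
  have hu_mem : (x, u) ∈ K := (hmem _).2 (R.refl' _)
  have e1 : Even K.card := even_card_of_involution K D.edge
    (fun a ha => (hmem _).2 (R.trans' ((hmem _).1 ha) (hRe a))) D.edge_edge D.edge_ne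
  -- Edges pair off all of `K`, whereas arcs away from `x` pair off all of it except `(x, u)`: the
  -- parities clash.
  have e2 : Even (K.erase (x, u)).card := by
    refine even_card_of_involution _ (D.smooth s) (fun a ha => ?_) (smooth_smooth s) (smooth_ne s)
    rw [Finset.mem_erase] at ha ⊢
    have hax : a.1 ≠ x := by
      rintro rfl
      exact ha.1 (Prod.ext rfl (hKx a.2 ha.2))
    refine ⟨fun h => hax ?_, (hmem _).2 (R.trans' ((hmem _).1 ha.2) (hRs a hax))⟩
    rw [← smooth_fst s a, h]
  have := Finset.card_erase_add_one hu_mem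
  rw [← this] at e1
  exact (Nat.not_even_iff_odd.2 e2.add_one) e1

/-! ### Splitting a circle -/

section Split

variable {s : D.KState} {x : Fin D.n}

/-- Each of the two new arcs at `x` joins ends that `side_connected` already puts on one circle of
`s`. So the change can only refine circles; no other circle is rearranged. -/
theorem circleSetoid_update_le (hb : D.IsBichord (Function.update s x .B) x) :
    D.circleSetoid (Function.update s x .B) ≤ D.circleSetoid s := by
  refine circleSetoid_le (circleSetoid_edge s) fun a => ?_
  by_cases hax : a.1 = x
  · obtain ⟨y, i⟩ := a
    obtain rfl : y = x := hax
    rw [smooth_of_B (by simp)]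
    have key : ∀ u : Fin 4, (u = 1 ∨ u = 3) → D.circleSetoid s (Sum.inl (y, u)) (Sum.inl (y, u + 1)) :=
      fun u hu => side_connected (s' := Function.update s y .B)
        (fun z hz => by simp [hz]) (by simp) hb hu
    fin_cases i
    · exact (D.circleSetoid s).symm' (key 3 (Or.inr rfl))
    · exact key 1 (Or.inl rfl)
    · exact (D.circleSetoid s).symm' (key 1 (Or.inl rfl))
    · exact key 3 (Or.inr rfl)
  · rw [smooth_congr (t := s) (by simp [hax])]
    exact circleSetoid_smooth s a

theorem circleSetoid_one_three (hx : s x = .A) (hb : D.IsBichord (Function.update s x .B) x) :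
    D.circleSetoid s (Sum.inl (x, 1)) (Sum.inl (x, 3)) := by
  have h12 : D.circleSetoid s (Sum.inl (x, 1)) (Sum.inl (x, 2)) :=
    side_connected (s' := Function.update s x .B) (fun z hz => by simp [hz]) (by simp) hb
      (Or.inl rfl)
  have h23 := circleSetoid_smooth s (x, 2)
  rw [smooth_of_A hx] at h23
  exact (D.circleSetoid s).trans' h12 h23

/-- After the change, all four ends at `x` lie on the circles through ends 1 and 3. Fusing these two
circles therefore restores every arc of `s`. -/
theorem circleSetoid_update_or (hx : s x = .A) {p q : D.Pt} (h : D.circleSetoid s p q) :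
    D.circleSetoid (Function.update s x .B) p q ∨
    ((D.circleSetoid (Function.update s x .B) p (Sum.inl (x, 1)) ∨
      D.circleSetoid (Function.update s x .B) p (Sum.inl (x, 3))) ∧
     (D.circleSetoid (Function.update s x .B) q (Sum.inl (x, 1)) ∨
      D.circleSetoid (Function.update s x .B) q (Sum.inl (x, 3)))) := by
  set s' := Function.update s x .B with hs'
  have tr := fun {a b c} => (D.circleSetoid s').trans' (x := a) (y := b) (z := c)
  have sy := fun {a b} => (D.circleSetoid s').symm' (x := a) (y := b)
  let P : D.Pt → Prop := fun p =>
    D.circleSetoid s' p (Sum.inl (x, 1)) ∨ D.circleSetoid s' p (Sum.inl (x, 3))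
  have hP : ∀ {a b}, D.circleSetoid s' a b → P a → P b := by
    rintro a b hab (h | h)
    · exact Or.inl (tr (sy hab) h)
    · exact Or.inr (tr (sy hab) h)
  let R : Setoid D.Pt :=
    { r := fun p q => D.circleSetoid s' p q ∨ (P p ∧ P q)
      iseqv :=
        { refl := fun p => Or.inl ((D.circleSetoid s').refl' p)
          symm := by
            rintro p q (h | ⟨h1, h2⟩)
            · exact Or.inl (sy h)
            · exact Or.inr ⟨h2, h1⟩
          trans := by
            rintro p q r (h | ⟨h1, h2⟩) (h' | ⟨h1', h2'⟩)
            · exact Or.inl (tr h h')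
            · exact Or.inr ⟨hP (sy h) h1', h2'⟩
            · exact Or.inr ⟨h1, hP h' h2⟩
            · exact Or.inr ⟨h1, h2'⟩ } }
  have hle : D.circleSetoid s ≤ R := by
    refine circleSetoid_le (fun a => Or.inl (circleSetoid_edge s' a)) fun a => ?_
    by_cases hax : a.1 = x
    · obtain ⟨y, i⟩ := a
      obtain rfl : y = x := hax
      have hall : ∀ j : Fin 4, P (Sum.inl (y, j)) := by
        have key := fun j => circleSetoid_smooth s' (y, j)
        have hB : s' y = .B := by simp [hs']
        intro j
        have kj := key j
        rw [smooth_of_B hB] at kj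
        fin_cases j
        · exact Or.inr kj
        · exact Or.inl ((D.circleSetoid s').refl' _)
        · exact Or.inl kj
        · exact Or.inr ((D.circleSetoid s').refl' _)
      rw [smooth_of_A hx]
      exact Or.inr ⟨hall _, hall _⟩
    · rw [smooth_congr (t := s') (by simp [hs', hax])]
      exact Or.inl (circleSetoid_smooth s' a)
  exact hle h

end Split

end LinkDiagram

/-! ### Signs and adjacency under a split -/

namespace LinkDiagram

variable {D : LinkDiagram}

/-- The map from the circles of a finer state to those of a coarser state. -/
def circleMap {s t : D.KState} (hle : D.circleSetoid t ≤ D.circleSetoid s) :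
    D.Circle t → D.Circle s :=
  Quotient.map id fun _ _ hab => hle hab

theorem circleMap_surjective {s t : D.KState} (hle : D.circleSetoid t ≤ D.circleSetoid s) :
    Function.Surjective (circleMap hle) := by
  rintro ⟨p⟩
  exact ⟨Quotient.mk _ p, rfl⟩

theorem mk_eq_mk_iff {s : D.KState} {p q : D.Pt} :
    (Quotient.mk (D.circleSetoid s) p = Quotient.mk (D.circleSetoid s) q) ↔
      D.circleSetoid s p q := Quotient.eq

section Split

variable {s : D.KState} {x : Fin D.n}

theorem circleMap_one_three (hx : s x = .A) (hb : D.IsBichord (Function.update s x .B) x) :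
    circleMap (circleSetoid_update_le hb) (D.circleAt _ x 3) = D.circleAt s x 1 :=
  Quotient.sound ((D.circleSetoid s).symm' (circleSetoid_one_three hx hb))

theorem circleMap_eq (hx : s x = .A) (hb : D.IsBichord (Function.update s x .B) x)
    {c c' : D.Circle (Function.update s x .B)}
    (h : circleMap (circleSetoid_update_le hb) c = circleMap (circleSetoid_update_le hb) c') :
    c = c' ∨ ((c = D.circleAt _ x 1 ∨ c = D.circleAt _ x 3) ∧
      (c' = D.circleAt _ x 1 ∨ c' = D.circleAt _ x 3)) := by
  induction c using Quotient.inductionOn with | _ p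
  induction c' using Quotient.inductionOn with | _ q
  have h' : D.circleSetoid s p q := Quotient.exact h
  simp only [circleAt, mk_eq_mk_iff]
  exact circleSetoid_update_or hx h'

theorem circleMap_eq_circleAt (hx : s x = .A) (hb : D.IsBichord (Function.update s x .B) x)
    {c : D.Circle (Function.update s x .B)} :
    circleMap (circleSetoid_update_le hb) c = D.circleAt s x 1 ↔
      c = D.circleAt _ x 1 ∨ c = D.circleAt _ x 3 := by
  constructor
  · intro h
    have h' : circleMap (circleSetoid_update_le hb) c =
      circleMap (circleSetoid_update_le hb) (D.circleAt _ x 1) := h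
    rcases circleMap_eq hx hb h' with h | h
    · exact Or.inl h
    · exact h.1
  · rintro (rfl | rfl)
    · rfl
    · exact circleMap_one_three hx hb

-- Away from the two halves, `circleMap` is a bijection onto the circles other than the one that
-- splits. This is the bookkeeping behind the change of `theta`.
open Classical in
theorem sum_circle_split (hx : s x = .A) (hb : D.IsBichord (Function.update s x .B) x)
    (f : D.Circle s → ℤ) (g : D.Circle (Function.update s x .B) → ℤ)
    (hfg : ∀ c, c ≠ D.circleAt _ x 1 → c ≠ D.circleAt _ x 3 →
      g c = f (circleMap (circleSetoid_update_le hb) c)) :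
    ∑ c, g c + f (D.circleAt s x 1) =
      ∑ c, f c + g (D.circleAt _ x 1) + g (D.circleAt _ x 3) := by
  have h1 := Finset.add_sum_erase Finset.univ f (Finset.mem_univ (D.circleAt s x 1))
  have h2 := Finset.add_sum_erase Finset.univ g (Finset.mem_univ (D.circleAt _ x 1))
  have h3 := Finset.add_sum_erase (Finset.univ.erase (D.circleAt _ x 1)) g
    (a := D.circleAt _ x 3) (Finset.mem_erase.2 ⟨Ne.symm hb, Finset.mem_univ _⟩)
  have h4 : ∑ c ∈ (Finset.univ.erase (D.circleAt (Function.update s x .B) x 1)).erase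
      (D.circleAt _ x 3), g c = ∑ c ∈ Finset.univ.erase (D.circleAt s x 1), f c := by
    refine Finset.sum_nbij (circleMap (circleSetoid_update_le hb)) ?_ ?_ ?_ ?_
    · intro c hc
      simp only [Finset.mem_erase, Finset.mem_univ, and_true, ne_eq] at hc ⊢
      rw [circleMap_eq_circleAt hx hb]
      tauto
    · intro c hc c' hc' h
      simp only [Finset.coe_erase, Finset.coe_univ, Set.mem_sdiff, Set.mem_univ, true_and,
        Set.mem_singleton_iff] at hc hc'
      rcases circleMap_eq hx hb h with h | h
      · exact h
      · tauto
    · intro c hc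
      obtain ⟨c', rfl⟩ := circleMap_surjective (circleSetoid_update_le hb) c
      refine ⟨c', ?_, rfl⟩
      simp only [Finset.coe_erase, Finset.coe_univ, Set.mem_sdiff, Set.mem_univ, true_and,
        Set.mem_singleton_iff] at hc ⊢
      rw [circleMap_eq_circleAt hx hb] at hc
      tauto
    · intro c hc
      simp only [Finset.mem_erase, Finset.mem_univ, and_true, ne_eq] at hc
      exact hfg c hc.2 hc.1
  linarith

theorem hdeg_update (hx : s x = .A) (σ : D.Circle s → ℤˣ)
    (τ : D.Circle (Function.update s x .B) → ℤˣ) :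
    hdeg (⟨Function.update s x .B, τ⟩ : D.EState) = hdeg (⟨s, σ⟩ : D.EState) + 1 := by
  unfold hdeg
  have : (Finset.univ.filter fun y => Function.update s x .B y = .B) =
      insert x (Finset.univ.filter fun y => s y = .B) := by
    ext y
    by_cases hy : y = x
    · subst hy; simp
    · simp [hy]
  simp only [this]
  rw [Finset.card_insert_of_notMem (by simp [hx])]
  push_cast; ring

theorem AdjacentAt.fst_eq {S T : D.EState} (h : AdjacentAt x S T) :
    T.1 = Function.update S.1 x .B := by
  funext y
  by_cases hy : y = x
  · subst hy; simp [h.2.2.2.1]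
  · simp [hy, h.2.2.2.2.1 y hy]

/-- Adjacency at a crossing where a circle splits. -/
theorem adjacentAt_iff (hx : s x = .A) (hb : D.IsBichord (Function.update s x .B) x)
    (σ : D.Circle s → ℤˣ) (τ : D.Circle (Function.update s x .B) → ℤˣ) :
    AdjacentAt x ⟨s, σ⟩ ⟨Function.update s x .B, τ⟩ ↔
      (∀ c, c ≠ D.circleAt _ x 1 → c ≠ D.circleAt _ x 3 →
        τ c = σ (circleMap (circleSetoid_update_le hb) c)) ∧
      ((τ (D.circleAt _ x 1) : ℤ) + τ (D.circleAt _ x 3) = σ (D.circleAt s x 1) - 1) := by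
  have hd := hdeg_update hx σ τ
  have hle := circleSetoid_update_le hb
  have key : (∀ c, c ≠ D.circleAt _ x 1 → c ≠ D.circleAt _ x 3 →
        τ c = σ (circleMap (circleSetoid_update_le hb) c)) →
      (theta (⟨Function.update s x .B, τ⟩ : D.EState) + σ (D.circleAt s x 1) =
      theta (⟨s, σ⟩ : D.EState) + τ (D.circleAt _ x 1) + τ (D.circleAt _ x 3)) := by
    intro h
    exact sum_circle_split hx hb (fun c => (σ c : ℤ)) (fun c => (τ c : ℤ))
      (fun c h1 h3 => by rw [h c h1 h3])
  constructor
  · rintro ⟨-, hq, -, -, -, hag⟩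
    have h1 : ∀ c, c ≠ D.circleAt _ x 1 → c ≠ D.circleAt _ x 3 →
        τ c = σ (circleMap (circleSetoid_update_le hb) c) := by
      intro c h1 h3
      induction c using Quotient.inductionOn with | _ p
      refine (hag p fun q => ⟨fun h => ?_, fun h => hle h⟩).symm
      rcases circleSetoid_update_or hx h with h | ⟨h | h, -⟩
      · exact h
      · exact absurd (Quotient.sound h) h1
      · exact absurd (Quotient.sound h) h3
    refine ⟨h1, ?_⟩
    have := key h1
    unfold qdeg at hq
    linarith
  · rintro ⟨h1, h2⟩
    refine ⟨hd, ?_, hx, by simp, fun y hy => by simp [hy], fun p hp => ?_⟩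
    · have := key h1
      unfold qdeg
      linarith
    -- A half is never a common circle: one common to both states would pass through both ends 1 and
    -- 3, which the split separates.
    · have hp' : ∀ u v, (D.circleSetoid s (Sum.inl (x, u)) (Sum.inl (x, v))) →
          D.circleSetoid (Function.update s x .B) p (Sum.inl (x, u)) →
          D.circleSetoid (Function.update s x .B) p (Sum.inl (x, v)) := fun u v huv h =>
        (hp _).1 ((D.circleSetoid s).trans' (hle h) huv)
      have h13 := circleSetoid_one_three hx hb
      have hne : ¬ (D.circleSetoid (Function.update s x .B) p (Sum.inl (x, 1)) ∧
          D.circleSetoid (Function.update s x .B) p (Sum.inl (x, 3))) := fun h =>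
        hb (Quotient.sound ((D.circleSetoid _).trans' ((D.circleSetoid _).symm' h.1) h.2))
      refine (h1 (Quotient.mk _ p) (fun h => ?_) (fun h => ?_)).symm
      · have h' := Quotient.exact h
        exact hne ⟨h', hp' 1 3 h13 h'⟩
      · have h' := Quotient.exact h
        exact hne ⟨hp' 3 1 ((D.circleSetoid s).symm' h13) h', h'⟩

end Split

/-! ### The differential, crossing by crossing -/

open Classical in
/-- The sum of the enhanced states adjacent to `S` with change crossing `x`. -/
noncomputable def adjacentSum (x : Fin D.n) (S : D.EState) : D.Chain :=
  ∑ T ∈ Finset.univ.filter (fun T => AdjacentAt x S T), Finsupp.single T 1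

/-- The sign of the change of the crossing `x`. -/
def changeSign (s : D.KState) (x : Fin D.n) : ℤ :=
  (-1) ^ (Finset.univ.filter fun y => y < x ∧ s y = SmoothingLabel.B).card

/-- Grouping the terms by the change crossing reduces the differential to the study of one split at
a time. -/
theorem d_single (S : D.EState) :
    D.d (Finsupp.single S 1) = ∑ x, changeSign S.1 x • adjacentSum x S := by
  classical
  simp only [d, Finsupp.linearCombination_single, one_smul, incidence, adjacentSum,
    Finset.smul_sum, Finset.sum_filter]
  rw [Finset.sum_comm]
  refine Finset.sum_congr rfl fun T _ => ?_
  rw [← Finsupp.singleAddHom_apply, map_sum]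
  refine Finset.sum_congr rfl fun x _ => ?_
  split_ifs with h
  · simp [changeSign]
  · simp

theorem adjacentSum_of_B {x : Fin D.n} {S : D.EState} (h : S.1 x = .B) : adjacentSum x S = 0 := by
  classical
  unfold adjacentSum
  rw [Finset.filter_eq_empty_iff.2, Finset.sum_empty]
  intro T _ hT
  rw [hT.2.2.1] at h
  exact absurd h (by decide)

section Split

variable {s : D.KState} {x : Fin D.n}

theorem units_add_eq_zero {a b : ℤˣ} (h : (a : ℤ) + b = 0) :
    (a = -1 ∧ b = 1) ∨ (a = 1 ∧ b = -1) := by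
  rcases Int.units_eq_one_or a with rfl | rfl <;> rcases Int.units_eq_one_or b with rfl | rfl <;>
    simp at h ⊢

theorem units_add_eq_neg_two {a b : ℤˣ} (h : (a : ℤ) + b = -2) : a = -1 ∧ b = -1 := by
  rcases Int.units_eq_one_or a with rfl | rfl <;> rcases Int.units_eq_one_or b with rfl | rfl <;>
    simp at h ⊢

open Classical in
/-- A positive circle splits into a positive and a negative circle, in two ways. -/
theorem adjacentSum_of_pos (hx : s x = .A) (hb : D.IsBichord (Function.update s x .B) x)
    (σ : D.Circle s → ℤˣ) (hσ : σ (D.circleAt s x 1) = 1) :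
    adjacentSum x ⟨s, σ⟩ =
      Finsupp.single (⟨Function.update s x .B, Function.update
        (σ ∘ circleMap (circleSetoid_update_le hb)) (D.circleAt _ x 1) (-1)⟩ : D.EState) 1 +
      Finsupp.single (⟨Function.update s x .B, Function.update
        (σ ∘ circleMap (circleSetoid_update_le hb)) (D.circleAt _ x 3) (-1)⟩ : D.EState) 1 := by
  have hb' : D.circleAt (Function.update s x .B) x 1 ≠ D.circleAt _ x 3 := hb
  have hσ1 : σ (circleMap (circleSetoid_update_le hb) (D.circleAt _ x 1)) = 1 := by
    rw [(circleMap_eq_circleAt hx hb).2 (Or.inl rfl), hσ]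
  have hσ3 : σ (circleMap (circleSetoid_update_le hb) (D.circleAt _ x 3)) = 1 := by
    rw [(circleMap_eq_circleAt hx hb).2 (Or.inr rfl), hσ]
  have hne : (⟨Function.update s x .B, Function.update
        (σ ∘ circleMap (circleSetoid_update_le hb)) (D.circleAt _ x 1) (-1)⟩ : D.EState) ≠
      ⟨Function.update s x .B, Function.update
        (σ ∘ circleMap (circleSetoid_update_le hb)) (D.circleAt _ x 3) (-1)⟩ := by
    intro h
    have h' := congrFun (eq_of_heq (Sigma.mk.inj h).2) (D.circleAt _ x 1)
    rw [Function.update_self, Function.update_of_ne hb', Function.comp_apply, hσ1] at h'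
    exact absurd h' (by decide)
  have hset : (Finset.univ.filter fun T : D.EState => AdjacentAt x ⟨s, σ⟩ T) =
      {⟨Function.update s x .B, Function.update
        (σ ∘ circleMap (circleSetoid_update_le hb)) (D.circleAt _ x 1) (-1)⟩,
       ⟨Function.update s x .B, Function.update
        (σ ∘ circleMap (circleSetoid_update_le hb)) (D.circleAt _ x 3) (-1)⟩} := by
    ext T
    simp only [Finset.mem_filter, Finset.mem_univ, true_and, Finset.mem_insert,
      Finset.mem_singleton]
    constructor
    · intro h
      obtain ⟨t, τ⟩ := T
      obtain rfl : t = Function.update s x .B := h.fst_eq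
      rw [adjacentAt_iff hx hb] at h
      obtain ⟨h1, h2⟩ := h
      rw [hσ] at h2
      rcases units_add_eq_zero (by simpa using h2) with ⟨ha, hc⟩ | ⟨ha, hc⟩
      · left
        congr 1
        funext c
        by_cases hc1 : c = D.circleAt _ x 1
        · rw [hc1, Function.update_self, ha]
        · rw [Function.update_of_ne hc1, Function.comp_apply]
          by_cases hc3 : c = D.circleAt _ x 3
          · rw [hc3, hc, hσ3]
          · exact h1 c hc1 hc3
      · right
        congr 1
        funext c
        by_cases hc3 : c = D.circleAt _ x 3
        · rw [hc3, Function.update_self, hc]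
        · rw [Function.update_of_ne hc3, Function.comp_apply]
          by_cases hc1 : c = D.circleAt _ x 1
          · rw [hc1, ha, hσ1]
          · exact h1 c hc1 hc3
    · rintro (rfl | rfl) <;> rw [adjacentAt_iff hx hb]
      · refine ⟨fun c hc1 _ => by rw [Function.update_of_ne hc1, Function.comp_apply], ?_⟩
        rw [Function.update_self, Function.update_of_ne hb'.symm, Function.comp_apply, hσ3, hσ]
        simp
      · refine ⟨fun c _ hc3 => by rw [Function.update_of_ne hc3, Function.comp_apply], ?_⟩
        rw [Function.update_self, Function.update_of_ne hb', Function.comp_apply, hσ1, hσ]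
        simp
  unfold adjacentSum
  rw [hset, Finset.sum_pair hne]

/-- A negative circle splits into two negative circles. -/
theorem adjacentSum_of_neg (hx : s x = .A) (hb : D.IsBichord (Function.update s x .B) x)
    (σ : D.Circle s → ℤˣ) (hσ : σ (D.circleAt s x 1) = -1) :
    adjacentSum x ⟨s, σ⟩ = Finsupp.single (⟨Function.update s x .B,
        σ ∘ circleMap (circleSetoid_update_le hb)⟩ : D.EState) 1 := by
  classical
  have hσ1 : σ (circleMap (circleSetoid_update_le hb) (D.circleAt _ x 1)) = -1 := by
    rw [(circleMap_eq_circleAt hx hb).2 (Or.inl rfl), hσ]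
  have hσ3 : σ (circleMap (circleSetoid_update_le hb) (D.circleAt _ x 3)) = -1 := by
    rw [(circleMap_eq_circleAt hx hb).2 (Or.inr rfl), hσ]
  have hset : (Finset.univ.filter fun T : D.EState => AdjacentAt x ⟨s, σ⟩ T) =
      {⟨Function.update s x .B, σ ∘ circleMap (circleSetoid_update_le hb)⟩} := by
    ext T
    simp only [Finset.mem_filter, Finset.mem_univ, true_and, Finset.mem_singleton]
    constructor
    · intro h
      obtain ⟨t, τ⟩ := T
      obtain rfl : t = Function.update s x .B := h.fst_eq
      rw [adjacentAt_iff hx hb] at h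
      obtain ⟨h1, h2⟩ := h
      rw [hσ] at h2
      obtain ⟨ha, hc⟩ := units_add_eq_neg_two (a := τ (D.circleAt _ x 1))
        (b := τ (D.circleAt _ x 3)) (by rw [h2]; rfl)
      congr 1
      funext c
      rw [Function.comp_apply]
      by_cases hc1 : c = D.circleAt _ x 1
      · rw [hc1, ha, hσ1]
      · by_cases hc3 : c = D.circleAt _ x 3
        · rw [hc3, hc, hσ3]
        · exact h1 c hc1 hc3
    · rintro rfl
      rw [adjacentAt_iff hx hb]
      refine ⟨fun c _ _ => rfl, ?_⟩
      rw [Function.comp_apply, Function.comp_apply, hσ1, hσ3, hσ]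
      rfl
  unfold adjacentSum
  refine Eq.trans (Finset.sum_congr ?_ fun _ _ => rfl) (Finset.sum_singleton _ _)
  convert hset

/-! ### States with few negative circles -/

/-- All circles are positive. -/
noncomputable def plusState (s : D.KState) : D.Chain :=
  Finsupp.single (⟨s, fun _ => 1⟩ : D.EState) 1

open Classical in
/-- All circles are positive except the circle through `p`. -/
noncomputable def minusState (s : D.KState) (p : D.Pt) : D.Chain :=
  Finsupp.single
    (⟨s, fun c => if c = Quotient.mk (D.circleSetoid s) p then -1 else 1⟩ : D.EState) 1

open Classical in
/-- All circles are positive except the circles through `p` and `q`; zero if these coincide. -/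
noncomputable def twoMinusState (s : D.KState) (p q : D.Pt) : D.Chain :=
  if D.circleSetoid s p q then 0 else
  Finsupp.single
    (⟨s, fun c => if c = Quotient.mk (D.circleSetoid s) p ∨
      c = Quotient.mk (D.circleSetoid s) q then -1 else 1⟩ : D.EState) 1

theorem minusState_congr {s : D.KState} {p q : D.Pt} (h : D.circleSetoid s p q) :
    minusState s p = minusState s q := by
  unfold minusState
  rw [mk_eq_mk_iff.2 h]

theorem twoMinusState_comm (s : D.KState) (p q : D.Pt) :
    twoMinusState s p q = twoMinusState s q p := by
  have h : D.circleSetoid s p q ↔ D.circleSetoid s q p := (D.circleSetoid s).comm'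
  by_cases hpq : D.circleSetoid s p q
  · exact (if_pos hpq).trans (if_pos (h.1 hpq)).symm
  · refine (if_neg hpq).trans (Eq.trans ?_ (if_neg (fun h' => hpq (h.2 h'))).symm)
    congr 2
    funext c
    congr 1
    exact propext or_comm

theorem twoMinusState_self (s : D.KState) (p : D.Pt) : twoMinusState s p p = 0 :=
  if_pos ((D.circleSetoid s).refl' p)

theorem twoMinusState_congr {s : D.KState} {p q q' : D.Pt} (h : D.circleSetoid s q q') :
    twoMinusState s p q = twoMinusState s p q' := by
  have h1 : D.circleSetoid s p q ↔ D.circleSetoid s p q' :=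
    ⟨fun h' => (D.circleSetoid s).trans' h' h,
      fun h' => (D.circleSetoid s).trans' h' ((D.circleSetoid s).symm' h)⟩
  by_cases hpq : D.circleSetoid s p q
  · exact (if_pos hpq).trans (if_pos (h1.1 hpq)).symm
  · refine (if_neg hpq).trans (Eq.trans ?_ (if_neg (fun h' => hpq (h1.2 h'))).symm)
    rw [mk_eq_mk_iff.2 h]

theorem adjacentSum_plus (hx : s x = .A) (hb : D.IsBichord (Function.update s x .B) x) :
    adjacentSum x (⟨s, fun _ => 1⟩ : D.EState) =
      minusState (Function.update s x .B) (Sum.inl (x, 1)) +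
      minusState (Function.update s x .B) (Sum.inl (x, 3)) := by
  classical
  rw [adjacentSum_of_pos hx hb _ rfl]
  unfold minusState
  congr 4 <;> funext c <;> simp only [Function.update_apply, Function.comp_apply] <;> rfl

/-- If the negative circle does not split, either half may become the second negative one. If it
does split, `p` lies on one half: that summand is zero by the convention in `twoMinusState`, and the
other makes both halves negative. The convention thus makes the formula uniform. -/
theorem adjacentSum_minus (hx : s x = .A) (hb : D.IsBichord (Function.update s x .B) x)
    (p : D.Pt) (σ : D.Circle s → ℤˣ)
    (hσ : ∀ q, σ (Quotient.mk _ q) = -1 ↔ D.circleSetoid s q p) :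
    adjacentSum x (⟨s, σ⟩ : D.EState) =
      twoMinusState (Function.update s x .B) p (Sum.inl (x, 1)) +
      twoMinusState (Function.update s x .B) p (Sum.inl (x, 3)) := by
  classical
  have hle := circleSetoid_update_le hb
  have h13 : ¬ D.circleSetoid (Function.update s x .B) (Sum.inl (x, 1)) (Sum.inl (x, 3)) :=
    fun h => hb (Quotient.sound h)
  have hσ' : ∀ q, ¬ D.circleSetoid s q p → σ (Quotient.mk _ q) = 1 := fun q hq =>
    (Int.units_eq_one_or _).resolve_right (fun h => hq ((hσ q).1 h))
  have hn : D.circleSetoid s (Sum.inl (x, 1)) p →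
      (Function.comp σ (circleMap (circleSetoid_update_le hb))) = fun c =>
        if c = Quotient.mk _ (Sum.inl (x, 1)) ∨ c = Quotient.mk _ (Sum.inl (x, 3)) then -1 else 1 := by
    intro hp
    funext c
    have h := circleMap_eq_circleAt hx hb (c := c)
    change (_ ↔ c = Quotient.mk _ _ ∨ c = Quotient.mk _ _) at h
    simp only [← h]
    induction c using Quotient.inductionOn with | _ q
    change σ (Quotient.mk _ q) = if (Quotient.mk (D.circleSetoid s) q) = Quotient.mk _ _ then _ else _
    simp only [mk_eq_mk_iff]
    split_ifs with h
    · exact (hσ q).2 ((D.circleSetoid s).trans' h hp)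
    · exact hσ' q fun h' => h ((D.circleSetoid s).trans' h' ((D.circleSetoid s).symm' hp))
  by_cases hp : D.circleSetoid s (Sum.inl (x, 1)) p
  · rw [adjacentSum_of_neg hx hb σ ((hσ _).2 hp), hn hp]
    rcases circleSetoid_update_or hx hp with h | ⟨-, h⟩
    · have h' := (D.circleSetoid _).symm' h
      rw [twoMinusState_comm _ p, twoMinusState_comm _ p, twoMinusState_congr h',
        twoMinusState_congr h', twoMinusState_self, zero_add, twoMinusState_comm]
      unfold twoMinusState
      rw [if_neg h13]
    · rcases h with h | h
      · rw [twoMinusState_comm _ p, twoMinusState_comm _ p, twoMinusState_congr h,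
        twoMinusState_congr h, twoMinusState_self, zero_add, twoMinusState_comm]
        unfold twoMinusState
        rw [if_neg h13]
      · rw [twoMinusState_comm _ p, twoMinusState_comm _ p, twoMinusState_congr h,
        twoMinusState_congr h, twoMinusState_self, add_zero]
        unfold twoMinusState
        rw [if_neg h13]
  · have hp1 : ¬ D.circleSetoid (Function.update s x .B) p (Sum.inl (x, 1)) := fun h =>
      hp ((D.circleSetoid s).symm' (hle h))
    have hp3 : ¬ D.circleSetoid (Function.update s x .B) p (Sum.inl (x, 3)) := fun h =>
      hp ((D.circleSetoid s).trans' (circleSetoid_one_three hx hb)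
        ((D.circleSetoid s).symm' (hle h)))
    have hq : ∀ q, D.circleSetoid s q p ↔ D.circleSetoid (Function.update s x .B) q p := by
      refine fun q => ⟨fun h => ?_, fun h => hle h⟩
      rcases circleSetoid_update_or hx h with h | ⟨-, h | h⟩
      exacts [h, absurd h hp1, absurd h hp3]
    rw [adjacentSum_of_pos hx hb σ (hσ' _ hp)]
    unfold twoMinusState
    rw [if_neg hp1, if_neg hp3]
    have hval : ∀ c, σ (circleMap hle c) = if c = Quotient.mk _ p then -1 else 1 := by
      intro c
      induction c using Quotient.inductionOn with | _ q
      change σ (Quotient.mk _ q) = _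
      simp only [mk_eq_mk_iff]
      split_ifs with h
      · exact (hσ q).2 ((hq q).2 h)
      · exact hσ' q (fun h' => h ((hq q).1 h'))
    congr 4 <;> funext c <;> simp only [Function.update_apply, Function.comp_apply, hval, circleAt] <;>
      split_ifs <;> tauto

end Split

end LinkDiagram

namespace LinkDiagram

variable {D : LinkDiagram}

/-! ### A parity invariant of chains -/

open Classical in
/-- The parity of the number of terms over the Kauffman state `t` with exactly one negative
circle. -/
noncomputable def oneMinusParity (t : D.KState) : D.Chain →ₗ[ℤ] ZMod 2 :=
  Finsupp.linearCombination ℤ fun T : D.EState =>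
    if T.1 = t ∧ (Finset.univ.filter fun c => T.2 c = -1).card = 1 then (1 : ZMod 2) else 0

open Classical in
theorem oneMinusParity_single (t : D.KState) (T : D.EState) :
    oneMinusParity t (Finsupp.single T 1) =
      if T.1 = t ∧ (Finset.univ.filter fun c => T.2 c = -1).card = 1 then (1 : ZMod 2) else 0 := by
  simp only [oneMinusParity, Finsupp.linearCombination_single, one_smul]

open Classical in
theorem oneMinusParity_minusState (t s : D.KState) (p : D.Pt) :
    oneMinusParity t (minusState s p) = if s = t then 1 else 0 := by
  unfold minusState
  rw [oneMinusParity_single]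
  have : (Finset.univ.filter fun c : D.Circle s =>
      (if c = Quotient.mk (D.circleSetoid s) p then (-1 : ℤˣ) else 1) = -1) =
      {Quotient.mk (D.circleSetoid s) p} := by
    ext c
    simp only [Finset.mem_filter, Finset.mem_univ, true_and, Finset.mem_singleton]
    split_ifs with h <;> simp [h]
  simp only [this, Finset.card_singleton, and_true]

/-- A positive split gives two terms with the same number of negative circles, which cancel mod 2. A
negative split leaves at least two negative circles and is not counted. -/
theorem oneMinusParity_adjacentSum {t : D.KState} (ht : ∀ x, t x = .B → D.IsBichord t x)
    (x : Fin D.n) (S : D.EState) : oneMinusParity t (adjacentSum x S) = 0 := by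
  classical
  obtain ⟨s, σ⟩ := S
  cases hx : s x with
  | B => rw [adjacentSum_of_B hx, map_zero]
  | A =>
    by_cases hst : Function.update s x .B = t
    · subst hst
      have hb := ht x (by simp)
      have hb' : D.circleAt (Function.update s x .B) x 1 ≠ D.circleAt _ x 3 := hb
      have hσ1 := congrArg σ ((circleMap_eq_circleAt hx hb).2 (Or.inl rfl))
      have hσ3 := congrArg σ ((circleMap_eq_circleAt hx hb).2 (Or.inr rfl))
      rcases Int.units_eq_one_or (σ (D.circleAt s x 1)) with hσ | hσ
      · rw [hσ] at hσ1 hσ3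
        rw [adjacentSum_of_pos hx hb σ hσ, map_add, oneMinusParity_single, oneMinusParity_single]
        have key : ∀ c₀, σ (circleMap (circleSetoid_update_le hb) c₀) = 1 →
            (Finset.univ.filter fun c => Function.update
              (σ ∘ circleMap (circleSetoid_update_le hb)) c₀ (-1) c = -1).card =
            (Finset.univ.filter fun c => σ (circleMap (circleSetoid_update_le hb) c) = -1).card
              + 1 := by
          intro c₀ hc₀
          rw [← Finset.card_insert_of_notMem (a := c₀) (by simp [hc₀])]
          congr 1
          ext c
          by_cases hc : c = c₀
          · subst hc; simp
          · simp [hc]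
        simp only [key _ hσ1, key _ hσ3]
        split_ifs <;> decide
      · rw [hσ] at hσ1 hσ3
        rw [adjacentSum_of_neg hx hb σ hσ, oneMinusParity_single, if_neg]
        rintro ⟨-, h⟩
        obtain ⟨c₀, hc₀⟩ := Finset.card_eq_one.1 h
        have m1 : D.circleAt (Function.update s x .B) x 1 ∈ ({c₀} : Finset _) :=
          hc₀ ▸ Finset.mem_filter.2 ⟨Finset.mem_univ _, hσ1⟩
        have m3 : D.circleAt (Function.update s x .B) x 3 ∈ ({c₀} : Finset _) :=
          hc₀ ▸ Finset.mem_filter.2 ⟨Finset.mem_univ _, hσ3⟩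
        rw [Finset.mem_singleton] at m1 m3
        exact hb' (m1.trans m3.symm)
    · unfold adjacentSum
      rw [map_sum]
      refine Finset.sum_eq_zero fun T hT => ?_
      rw [oneMinusParity_single, if_neg]
      rintro ⟨h, -⟩
      exact hst ((Finset.mem_filter.1 hT).2.fst_eq.symm.trans h)

/-- The parity invariant vanishes on boundaries when all `B`-labelled crossings are bichords. -/
theorem oneMinusParity_d {t : D.KState} (ht : ∀ x, t x = .B → D.IsBichord t x) (W : D.Chain) :
    oneMinusParity t (D.d W) = 0 := by
  induction W using Finsupp.induction_linear with
  | zero => simp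
  | add f g hf hg => rw [map_add, map_add, hf, hg, add_zero]
  | single S n =>
    have : (Finsupp.single S n : D.Chain) = n • Finsupp.single S 1 := by simp
    rw [this, map_smul, map_smul, d_single, map_sum, Finset.sum_eq_zero, smul_zero]
    intro x _
    rw [map_smul, oneMinusParity_adjacentSum ht, smul_zero]

end LinkDiagram

/-! ### Coordinates and arcs in a ladder -/

namespace LinkDiagram

namespace LadderSystem

variable {D : LinkDiagram} {s₀ : D.KState} {k : ℕ} {h : Fin k → ℕ} (H : LadderSystem D s₀ h)

theorem step_eq_iff {i j : Fin k} {a : Fin (h i)} {b : Fin (h j)} :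
    H.step i a = H.step j b ↔ (⟨i, a⟩ : Σ i, Fin (h i)) = ⟨j, b⟩ := by
  constructor
  · intro hab
    rcases lt_trichotomy i j with hij | rfl | hij
    · exact absurd hab (H.order_ladders i j hij a b).ne
    · rcases lt_trichotomy a b with h' | rfl | h'
      · exact absurd hab (H.order_steps i a b h').ne
      · rfl
      · exact absurd hab (H.order_steps i b a h').ne'
    · exact absurd hab (H.order_ladders j i hij b a).ne'
  · rintro ⟨⟩
    rfl

theorem step_inj {i : Fin k} {a b : Fin (h i)} : H.step i a = H.step i b ↔ a = b := by
  rw [step_eq_iff, Sigma.mk.injEq, heq_eq_eq]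
  exact and_iff_right rfl

theorem stateOf_step (M : (i : Fin k) → Finset (Fin (h i))) (i : Fin k) (a : Fin (h i)) :
    H.stateOf M (H.step i a) = .B ↔ a ∈ M i := by
  unfold stateOf
  constructor
  · intro hB
    by_contra ha
    rw [if_neg, H.step_blue] at hB
    · exact absurd hB (by decide)
    · rintro ⟨j, b, hb, hjb⟩
      rw [step_eq_iff] at hjb
      cases hjb
      exact ha hb
  · intro ha
    exact if_pos ⟨i, a, ha, rfl⟩

theorem stateOf_of_B (M : (i : Fin k) → Finset (Fin (h i))) {x : Fin D.n} (hx : s₀ x = .B) :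
    H.stateOf M x = .B := by
  unfold stateOf
  split_ifs
  exacts [rfl, hx]

theorem ne_step_of_B {x : Fin D.n} (hx : s₀ x = .B) (i : Fin k) (a : Fin (h i)) :
    H.step i a ≠ x := by
  rintro rfl
  rw [H.step_blue] at hx
  exact absurd hx (by decide)

theorem step_or_B (x : Fin D.n) : (∃ i a, H.step i a = x) ∨ s₀ x = .B := by
  cases hx : s₀ x
  · exact Or.inl (H.exists_step x hx)
  · exact Or.inr rfl

/-- The end number `e` of a step, counted from the front side of its scar. -/
def stepEnd (i : Fin k) (a : Fin (h i)) (e : Fin 4) : CrossingEnd D.n :=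
  (H.step i a, H.dir i a + e)

theorem eq_stepEnd (i : Fin k) (a : Fin (h i)) (e : Fin 4) :
    (H.step i a, e) = H.stepEnd i a (e - H.dir i a) := by
  simp [stepEnd]

theorem edge_zero {i : Fin k} {a b : Fin (h i)} (hab : (a : ℕ) + 1 = b) :
    D.edge (H.stepEnd i a 0) = H.stepEnd i b 3 := by
  have := (H.parallel i a b hab).1
  simpa [stepEnd] using this

theorem edge_one {i : Fin k} {a b : Fin (h i)} (hab : (a : ℕ) + 1 = b) :
    D.edge (H.stepEnd i a 1) = H.stepEnd i b 2 :=
  (H.parallel i a b hab).2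

/-- Relative ends 0, 1 look forward and 2, 3 backward. As `dir` is odd, the pairings of the two
smoothings are interchanged with respect to absolute numbering: red arcs join the two ends on one
side of the scar, blue arcs run along the ladder. -/
theorem smooth_B {s : D.KState} {i : Fin k} {a : Fin (h i)} (hs : s (H.step i a) = .B)
    (e : Fin 4) : D.smooth s (H.stepEnd i a e) = H.stepEnd i a (![1, 0, 3, 2] e) := by
  unfold stepEnd
  rw [smooth_of_B hs]
  congr 1
  rcases H.dir_eq i a with hd | hd <;> rw [hd] <;> dsimp only <;> revert e <;> decide

theorem smooth_A {s : D.KState} {i : Fin k} {a : Fin (h i)} (hs : s (H.step i a) = .A)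
    (e : Fin 4) : D.smooth s (H.stepEnd i a e) = H.stepEnd i a (![3, 2, 1, 0] e) := by
  unfold stepEnd
  rw [smooth_of_A hs]
  congr 1
  rcases H.dir_eq i a with hd | hd <;> rw [hd] <;> dsimp only <;> revert e <;> decide

/-- The point of the diagram given by a step end. -/
def stepPt (i : Fin k) (a : Fin (h i)) (e : Fin 4) : D.Pt := Sum.inl (H.stepEnd i a e)

section Arcs

variable {s : D.KState} {i : Fin k} {a b : Fin (h i)}

theorem front_red (hs : s (H.step i a) = .B) :
    D.circleSetoid s (H.stepPt i a 0) (H.stepPt i a 1) := by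
  have := circleSetoid_smooth s (H.stepEnd i a 0)
  rwa [H.smooth_B hs] at this

theorem back_red (hs : s (H.step i a) = .B) :
    D.circleSetoid s (H.stepPt i a 2) (H.stepPt i a 3) := by
  have := circleSetoid_smooth s (H.stepEnd i a 2)
  rwa [H.smooth_B hs] at this

theorem side_blue (hs : s (H.step i a) = .A) :
    D.circleSetoid s (H.stepPt i a 3) (H.stepPt i a 0) := by
  have := circleSetoid_smooth s (H.stepEnd i a 3)
  rwa [H.smooth_A hs] at this

theorem side_blue' (hs : s (H.step i a) = .A) :
    D.circleSetoid s (H.stepPt i a 2) (H.stepPt i a 1) := by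
  have := circleSetoid_smooth s (H.stepEnd i a 2)
  rwa [H.smooth_A hs] at this

theorem next (s : D.KState) (hab : (a : ℕ) + 1 = b) :
    D.circleSetoid s (H.stepPt i a 0) (H.stepPt i b 3) := by
  have := circleSetoid_edge s (H.stepEnd i a 0)
  rwa [H.edge_zero hab] at this

theorem next' (s : D.KState) (hab : (a : ℕ) + 1 = b) :
    D.circleSetoid s (H.stepPt i a 1) (H.stepPt i b 2) := by
  have := circleSetoid_edge s (H.stepEnd i a 1)
  rwa [H.edge_one hab] at this

theorem blue_run (hab : a ≤ b) (hs : ∀ c, a ≤ c → c < b → s (H.step i c) = .A) :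
    D.circleSetoid s (H.stepPt i a 3) (H.stepPt i b 3) ∧
    D.circleSetoid s (H.stepPt i a 2) (H.stepPt i b 2) := by
  obtain ⟨b, hb⟩ := b
  induction b with
  | zero =>
    obtain rfl : a = ⟨0, hb⟩ := le_antisymm hab (Fin.mk_le_of_le_val (Nat.zero_le _))
    exact ⟨(D.circleSetoid s).refl' _, (D.circleSetoid s).refl' _⟩
  | succ b ih =>
    rcases hab.eq_or_lt with rfl | hlt
    · exact ⟨(D.circleSetoid s).refl' _, (D.circleSetoid s).refl' _⟩
    · have hb' : b < h i := by omega
      have hle : a ≤ ⟨b, hb'⟩ := by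
        rw [Fin.lt_def] at hlt
        rw [Fin.le_def]
        simpa using Nat.lt_succ_iff.1 hlt
      have hlt' : (⟨b, hb'⟩ : Fin (h i)) < ⟨b + 1, hb⟩ := by simp [Fin.lt_def]
      obtain ⟨h1, h2⟩ := ih hb' hle fun c h1 h2 => hs c h1 (h2.trans hlt')
      have hA := hs _ hle hlt'
      exact ⟨(D.circleSetoid s).trans' h1 ((D.circleSetoid s).trans' (H.side_blue hA)
          (H.next s rfl)),
        (D.circleSetoid s).trans' h2 ((D.circleSetoid s).trans' (H.side_blue' hA)
          (H.next' s rfl))⟩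

/-- Walking along a ladder from the front of the step `a` to the back of the step `b`. -/
theorem front_run (hab : a < b) (hs : ∀ c, a < c → c < b → s (H.step i c) = .A) :
    D.circleSetoid s (H.stepPt i a 0) (H.stepPt i b 3) ∧
    D.circleSetoid s (H.stepPt i a 1) (H.stepPt i b 2) := by
  have ha : (a : ℕ) + 1 < h i := lt_of_le_of_lt (Nat.succ_le_of_lt hab) b.2
  have hle : (⟨a + 1, ha⟩ : Fin (h i)) ≤ b := Fin.le_def.2 (Nat.succ_le_of_lt hab)
  obtain ⟨h1, h2⟩ := H.blue_run (s := s) hle fun c h1 h2 =>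
    hs c (Fin.lt_def.2 (Nat.lt_of_succ_le (Fin.le_def.1 h1))) h2
  exact ⟨(D.circleSetoid s).trans' (H.next s rfl) h1, (D.circleSetoid s).trans' (H.next' s rfl) h2⟩

theorem front_back (hab : a < b) (hb : s (H.step i b) = .B)
    (hs : ∀ c, a < c → c < b → s (H.step i c) = .A) :
    D.circleSetoid s (H.stepPt i a 0) (H.stepPt i b 2) :=
  (D.circleSetoid s).trans' (H.front_run hab hs).1 ((D.circleSetoid s).symm' (H.back_red hb))

end Arcs

/-- The index of the first step. -/
def firstIdx (i : Fin k) : Fin (h i) := ⟨0, H.height_pos i⟩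

/-- The index of the last step. -/
def lastIdx (i : Fin k) : Fin (h i) := ⟨h i - 1, Nat.sub_lt (H.height_pos i) one_pos⟩

theorem firstIdx_le (i : Fin k) (a : Fin (h i)) : H.firstIdx i ≤ a := Fin.le_def.2 (Nat.zero_le _)

theorem le_lastIdx (i : Fin k) (a : Fin (h i)) : a ≤ H.lastIdx i :=
  Fin.le_def.2 (Nat.le_sub_one_of_lt a.2)

/-- The outer extreme of a ladder before its first step. -/
def outerPt (i : Fin k) : D.Pt := H.stepPt i (H.firstIdx i) 2

/-- The extreme of a ladder after its last step. -/
def endPt (i : Fin k) : D.Pt := H.stepPt i (H.lastIdx i) 0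

section Extremes

variable {s : D.KState} {i : Fin k} {a : Fin (h i)}

theorem outerPt_min (hs : ∀ c, c < a → s (H.step i c) = .A) :
    D.circleSetoid s (H.outerPt i) (H.stepPt i a 2) :=
  (H.blue_run (H.firstIdx_le i a) fun c _ hc => hs c hc).2

theorem outerPt_other (ha : s (H.step i a) = .B) (hs : ∀ c, c < a → s (H.step i c) = .A) :
    D.circleSetoid s (H.outerPt i) (H.stepPt i (H.firstIdx i) 3) :=
  (D.circleSetoid s).trans' (H.outerPt_min hs) ((D.circleSetoid s).trans' (H.back_red ha)
    ((D.circleSetoid s).symm' (H.blue_run (H.firstIdx_le i a) fun c _ hc => hs c hc).1))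

/-- Beyond the last red step both sides of the ladder run freely to its end, and the front arc of
that step joins them. -/
theorem endPt_max_all (ha : s (H.step i a) = .B) (hs : ∀ c, a < c → s (H.step i c) = .A) :
    D.circleSetoid s (H.endPt i) (H.stepPt i a 0) ∧
    D.circleSetoid s (H.endPt i) (H.stepPt i (H.lastIdx i) 1) := by
  rcases (H.le_lastIdx i a).eq_or_lt with h' | hlt
  · unfold endPt
    rw [← h']
    exact ⟨(D.circleSetoid s).refl' _, H.front_red ha⟩
  · have h1 := H.front_run (s := s) hlt fun c hc _ => hs c hc
    have hA := hs _ hlt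
    have h2 : D.circleSetoid s (H.endPt i) (H.stepPt i a 0) := (D.circleSetoid s).symm'
      ((D.circleSetoid s).trans' h1.1 (H.side_blue hA))
    exact ⟨h2, (D.circleSetoid s).trans' h2 ((D.circleSetoid s).trans' (H.front_red ha)
      ((D.circleSetoid s).trans' h1.2 (H.side_blue' hA)))⟩

theorem exists_first_red (ha : s (H.step i a) = .B) :
    ∃ b, s (H.step i b) = .B ∧ ∀ c, c < b → s (H.step i c) = .A := by
  classical
  have hne : (Finset.univ.filter fun b => s (H.step i b) = .B).Nonempty := ⟨a, by simp [ha]⟩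
  refine ⟨_, (Finset.mem_filter.1 (Finset.min'_mem _ hne)).2, fun c hc => ?_⟩
  cases hs : s (H.step i c)
  · rfl
  · exact absurd (Finset.min'_le _ c (by simp [hs])) (not_le.2 hc)

theorem exists_last_red (ha : s (H.step i a) = .B) :
    ∃ b, s (H.step i b) = .B ∧ ∀ c, b < c → s (H.step i c) = .A := by
  classical
  have hne : (Finset.univ.filter fun b => s (H.step i b) = .B).Nonempty := ⟨a, by simp [ha]⟩
  refine ⟨_, (Finset.mem_filter.1 (Finset.max'_mem _ hne)).2, fun c hc => ?_⟩
  cases hs : s (H.step i c)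
  · rfl
  · exact absurd (Finset.le_max' _ c (by simp [hs])) (not_le.2 hc)

end Extremes

/-! ### Red steps of a ladder with several red steps are bichords -/

/-- The part of the ladder strictly between two red scars is closed off: no edge or arc leaves it.
It contains the front of `a` and the back of `c`, but neither the back of `a` nor the front of `c`.
-/
theorem not_circleSetoid_front_back {s : D.KState} {i : Fin k} {a c : Fin (h i)} (hac : a < c)
    (ha : s (H.step i a) = .B) (hc : s (H.step i c) = .B) :
    ¬ D.circleSetoid s (H.stepPt i a 0) (H.stepPt i a 2) ∧
    ¬ D.circleSetoid s (H.stepPt i c 2) (H.stepPt i c 0) := by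
  -- The closed-off part: front ends from `a` up to but excluding `c`, back ends after `a` up to and
  -- including `c`.
  let K : Set (CrossingEnd D.n) :=
    {p | ∃ b, (a ≤ b ∧ b < c ∧ (p = H.stepEnd i b 0 ∨ p = H.stepEnd i b 1)) ∨
      (a < b ∧ b ≤ c ∧ (p = H.stepEnd i b 2 ∨ p = H.stepEnd i b 3))}
  have hK : ∀ (b : Fin (h i)) (e : Fin 4), H.stepEnd i b e ∈ K ↔
      (a ≤ b ∧ b < c ∧ (e = 0 ∨ e = 1)) ∨ (a < b ∧ b ≤ c ∧ (e = 2 ∨ e = 3)) := by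
    intro b e
    have heq : ∀ b' e', H.stepEnd i b e = H.stepEnd i b' e' ↔ b = b' ∧ e = e' := by
      intro b' e'
      unfold stepEnd
      rw [Prod.mk.injEq, H.step_inj]
      constructor
      · rintro ⟨rfl, he⟩
        exact ⟨rfl, add_left_cancel he⟩
      · rintro ⟨rfl, rfl⟩
        exact ⟨rfl, rfl⟩
    simp only [K, Set.mem_ofPred_eq, heq]
    constructor
    · rintro ⟨b', ⟨h1, h2, ⟨rfl, rfl⟩ | ⟨rfl, rfl⟩⟩ | ⟨h1, h2, ⟨rfl, rfl⟩ | ⟨rfl, rfl⟩⟩⟩ <;>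
        simp [h1, h2]
    · rintro (⟨h1, h2, rfl | rfl⟩ | ⟨h1, h2, rfl | rfl⟩) <;> exact ⟨b, by simp [h1, h2]⟩
  have hKall : ∀ (b : Fin (h i)) (e : Fin 4), a < b → b < c → H.stepEnd i b e ∈ K := by
    intro b e h1 h2
    rw [hK]
    have : e = 0 ∨ e = 1 ∨ e = 2 ∨ e = 3 := by revert e; decide
    have h1' := h1.le
    have h2' := h2.le
    tauto
  have hsmooth : ∀ p ∈ K, D.smooth s p ∈ K := by
    have haux : ∀ b, (a = b ∨ b = c ∨ (a < b ∧ b < c)) → ∀ e, H.stepEnd i b e ∈ K →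
        D.smooth s (H.stepEnd i b e) ∈ K := by
      rintro b (rfl | rfl | ⟨h1, h2⟩) e he
      · rw [H.smooth_B ha, hK]
        rw [hK] at he
        rcases he with ⟨-, -, rfl | rfl⟩ | ⟨h1, -⟩
        · simp [hac]
        · simp [hac]
        · exact absurd h1 (lt_irrefl _)
      · rw [H.smooth_B hc, hK]
        rw [hK] at he
        rcases he with ⟨-, h1, -⟩ | ⟨-, -, rfl | rfl⟩
        · exact absurd h1 (lt_irrefl _)
        · simp [hac]
        · simp [hac]
      · cases hb : s (H.step i b)
        · rw [H.smooth_A hb]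
          exact hKall b _ h1 h2
        · rw [H.smooth_B hb]
          exact hKall b _ h1 h2
    intro p hp
    obtain ⟨b, hb⟩ := id hp
    have hb' : ∃ e, p = H.stepEnd i b e := by
      rcases hb with ⟨-, -, h1 | h1⟩ | ⟨-, -, h1 | h1⟩ <;> exact ⟨_, h1⟩
    obtain ⟨e, rfl⟩ := hb'
    refine haux b ?_ e hp
    rcases hb with ⟨h1, h2, -⟩ | ⟨h1, h2, -⟩
    · rcases h1.eq_or_lt with h1 | h1 <;> tauto
    · rcases h2.eq_or_lt with h2 | h2 <;> tauto
  have hedge : ∀ p ∈ K, D.edge p ∈ K := by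
    rintro p ⟨b, ⟨h1, h2, hp⟩ | ⟨h1, h2, hp⟩⟩
    · have hlt : (b : ℕ) + 1 < h i := lt_of_le_of_lt (Nat.succ_le_of_lt h2) c.2
      have h3 : a < ⟨(b : ℕ) + 1, hlt⟩ := Fin.lt_def.2 (Nat.lt_succ_of_le h1)
      have h4 : ⟨(b : ℕ) + 1, hlt⟩ ≤ c := Fin.le_def.2 (Nat.succ_le_of_lt h2)
      rcases hp with rfl | rfl
      · rw [H.edge_zero (b := ⟨b + 1, hlt⟩) rfl, hK]
        simp [h3, h4]
      · rw [H.edge_one (b := ⟨b + 1, hlt⟩) rfl, hK]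
        simp [h3, h4]
    · have hpos : (a : ℕ) < b := h1
      have hle : (b : ℕ) ≤ c := h2
      have hlt : (b : ℕ) - 1 < h i := by omega
      have h3 : a ≤ ⟨(b : ℕ) - 1, hlt⟩ := Fin.le_def.2 (by change (a : ℕ) ≤ b - 1; omega)
      have h4 : ⟨(b : ℕ) - 1, hlt⟩ < c := Fin.lt_def.2 (by change (b : ℕ) - 1 < c; omega)
      have h5 : ((⟨(b : ℕ) - 1, hlt⟩ : Fin (h i)) : ℕ) + 1 = b := by
        change (b : ℕ) - 1 + 1 = b; omega
      rcases hp with rfl | rfl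
      · rw [← H.edge_one h5, D.edge_edge, hK]
        simp [h3, h4]
      · rw [← H.edge_zero h5, D.edge_edge, hK]
        simp [h3, h4]
  constructor
  · refine not_circleSetoid_of_closed K hedge hsmooth ?_ ?_
    · rw [hK]; simp [hac]
    · rw [hK]; simp
  · refine not_circleSetoid_of_closed K hedge hsmooth ?_ ?_
    · rw [hK]; simp [hac]
    · rw [hK]; simp

theorem isBichord_iff (s : D.KState) (i : Fin k) (a : Fin (h i)) :
    D.IsBichord s (H.step i a) ↔ ¬ D.circleSetoid s (H.stepPt i a 0) (H.stepPt i a 2) := by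
  unfold IsBichord circleAt stepPt stepEnd
  rw [Ne, mk_eq_mk_iff]
  rcases H.dir_eq i a with hd | hd <;> rw [hd]
  · rfl
  · rw [(D.circleSetoid s).comm']
    rfl

/-- Whichever side the other red step lies on, the region between the two contains exactly one of
the arcs meeting the scar of `a`. -/
theorem isBichord_of_two_red {s : D.KState} {i : Fin k} {a c : Fin (h i)} (hac : a ≠ c)
    (ha : s (H.step i a) = .B) (hc : s (H.step i c) = .B) : D.IsBichord s (H.step i a) := by
  rw [isBichord_iff]
  rcases lt_or_gt_of_ne hac with hlt | hlt
  · exact (H.not_circleSetoid_front_back hlt ha hc).1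
  · rw [(D.circleSetoid s).comm']
    exact (H.not_circleSetoid_front_back hlt hc ha).2

end LadderSystem

end LinkDiagram

namespace LinkDiagram

namespace LadderSystem

variable {D : LinkDiagram} {s₀ : D.KState} {k : ℕ} {h : Fin k → ℕ} (H : LadderSystem D s₀ h)

/-! ### Comparing the circles with those of the broken state -/

theorem brokenState_step (i : Fin k) (a : Fin (h i)) :
    H.brokenState (H.step i a) = .B ↔ a = H.firstIdx i := by
  unfold brokenState
  rw [H.stateOf_step, Finset.mem_singleton]
  rfl

theorem brokenState_first (i : Fin k) : H.brokenState (H.step i (H.firstIdx i)) = .B :=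
  (H.brokenState_step i _).2 rfl

theorem brokenState_lt (i : Fin k) {a : Fin (h i)} (ha : H.firstIdx i < a) :
    H.brokenState (H.step i a) = .A := by
  cases hs : H.brokenState (H.step i a)
  · rfl
  · exact absurd ((H.brokenState_step i a).1 hs) ha.ne'

theorem brokenState_of_B {x : Fin D.n} (hx : s₀ x = .B) : H.brokenState x = .B :=
  H.stateOf_of_B _ hx

/-- Periphery number one enters here: an unordered pair with one element is a coincidence of the two
extreme circles. -/
theorem brokenState_front_back {i : Fin k} (hp : H.peripheryNumber i = 1) :
    D.circleSetoid H.brokenState (H.stepPt i (H.firstIdx i) 2) (H.stepPt i (H.firstIdx i) 0) := by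
  unfold peripheryNumber periphery at hp
  have hmk : D.circleAt H.brokenState (H.first i) (H.firstDir i + 2) =
      D.circleAt H.brokenState (H.first i) (H.firstDir i) := by
    by_contra hne
    rw [Set.ncard_pair hne] at hp
    exact absurd hp (by decide)
  have := mk_eq_mk_iff.1 hmk
  have h0 : H.stepPt i (H.firstIdx i) 0 = Sum.inl (H.first i, H.firstDir i) := by
    unfold stepPt stepEnd
    rw [add_zero]
    rfl
  rw [h0]
  exact this

/-- All the ends of a ladder of periphery number one lie on one circle of the broken state. -/
theorem brokenState_stepPt {i : Fin k} (hp : H.peripheryNumber i = 1) (a : Fin (h i))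
    (e : Fin 4) : D.circleSetoid H.brokenState (H.outerPt i) (H.stepPt i a e) := by
  have tr := fun {a b c} => (D.circleSetoid H.brokenState).trans' (x := a) (y := b) (z := c)
  have h02 := H.brokenState_front_back hp
  have hB := H.brokenState_first i
  have he : e = 0 ∨ e = 1 ∨ e = 2 ∨ e = 3 := by revert e; decide
  have h0 : D.circleSetoid H.brokenState (H.outerPt i) (H.stepPt i (H.firstIdx i) 0) := h02
  have h1 := tr h0 (H.front_red hB)
  rcases (H.firstIdx_le i a).eq_or_lt with rfl | hlt
  · rcases he with rfl | rfl | rfl | rfl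
    exacts [h0, h1, (D.circleSetoid _).refl' _, H.back_red hB]
  · obtain ⟨r0, r1⟩ := H.front_run (s := H.brokenState) hlt fun c hc _ => H.brokenState_lt i hc
    have hA := H.brokenState_lt i hlt
    have h3 := tr h0 r0
    have h2 := tr h1 r1
    rcases he with rfl | rfl | rfl | rfl
    exacts [tr h3 (H.side_blue hA), tr h2 (H.side_blue' hA), h2, h3]

theorem smooth_stepEnd_eq (s : D.KState) (i : Fin k) (a : Fin (h i)) (e : Fin 4) :
    ∃ e', D.smooth s (H.stepEnd i a e) = H.stepEnd i a e' := by
  cases hs : s (H.step i a)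
  · exact ⟨_, H.smooth_A hs e⟩
  · exact ⟨_, H.smooth_B hs e⟩

/-- The circles of a state that agrees with `s₀` off the ladders are contained in those of the
broken state. -/
theorem circleSetoid_le_brokenState (hp : ∀ i, H.peripheryNumber i = 1) {s : D.KState}
    (hs : ∀ x, s₀ x = .B → s x = .B) : D.circleSetoid s ≤ D.circleSetoid H.brokenState := by
  refine circleSetoid_le (circleSetoid_edge _) fun p => ?_
  obtain ⟨x, e⟩ := p
  rcases H.step_or_B x with ⟨i, a, rfl⟩ | hx
  · rw [H.eq_stepEnd]
    obtain ⟨e', he'⟩ := H.smooth_stepEnd_eq s i a (e - H.dir i a)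
    rw [he']
    exact (D.circleSetoid _).trans' ((D.circleSetoid _).symm' (H.brokenState_stepPt (hp i) a _))
      (H.brokenState_stepPt (hp i) a e')
  · rw [smooth_congr (t := H.brokenState) (by rw [hs x hx, H.brokenState_of_B hx])]
    exact circleSetoid_smooth _ _

open Classical in
/-- The ends of the ladders are moved to the extremes of the ladders; only the extremes before the
first step are kept apart from the others. -/
noncomputable def collapse : D.Pt → D.Pt
  | Sum.inl p =>
    if hx : ∃ q : Σ i, Fin (h i), H.step q.1 q.2 = p.1 then
      if p = H.stepEnd hx.choose.1 (H.firstIdx hx.choose.1) 2 ∨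
        p = H.stepEnd hx.choose.1 (H.firstIdx hx.choose.1) 3 then H.outerPt hx.choose.1
      else H.endPt hx.choose.1
    else Sum.inl p
  | Sum.inr l => Sum.inr l

theorem stepEnd_inj {i : Fin k} {a b : Fin (h i)} {e e' : Fin 4} :
    H.stepEnd i a e = H.stepEnd i b e' ↔ a = b ∧ e = e' := by
  unfold stepEnd
  rw [Prod.mk.injEq, H.step_inj]
  constructor
  · rintro ⟨rfl, he⟩
    exact ⟨rfl, add_left_cancel he⟩
  · rintro ⟨rfl, rfl⟩
    exact ⟨rfl, rfl⟩

open Classical in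
theorem collapse_stepPt (i : Fin k) (a : Fin (h i)) (e : Fin 4) :
    H.collapse (H.stepPt i a e) =
      if a = H.firstIdx i ∧ (e = 2 ∨ e = 3) then H.outerPt i else H.endPt i := by
  have hx : ∃ q : Σ i, Fin (h i), H.step q.1 q.2 = (H.stepEnd i a e).1 := ⟨⟨i, a⟩, rfl⟩
  have hi : hx.choose.1 = i := by
    have h1 := hx.choose_spec
    change _ = H.step i a at h1
    rw [H.step_eq_iff] at h1
    exact congrArg Sigma.fst h1
  change (if hx : _ then _ else _) = _
  rw [dif_pos hx, hi]
  simp only [H.stepEnd_inj, and_or_left]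

theorem collapse_of_B {x : Fin D.n} (hx : s₀ x = .B) (e : Fin 4) :
    H.collapse (Sum.inl (x, e)) = Sum.inl (x, e) := by
  unfold collapse
  exact dif_neg fun ⟨q, hq⟩ => H.ne_step_of_B hx q.1 q.2 hq

/-- Points on one circle of the broken state stay on one circle when they are collapsed. -/
theorem collapse_related {s : D.KState} (hs : ∀ x, s₀ x = .B → s x = .B)
    (hred : ∀ i, ∃ a, s (H.step i a) = .B) {p q : D.Pt}
    (hpq : D.circleSetoid H.brokenState p q) :
    D.circleSetoid s (H.collapse p) (H.collapse q) := by
  have tr := fun {a b c} => (D.circleSetoid s).trans' (x := a) (y := b) (z := c)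
  have sy := fun {a b} => (D.circleSetoid s).symm' (x := a) (y := b)
  have rf := (D.circleSetoid s).refl'
  suffices hle : D.circleSetoid H.brokenState ≤ (D.circleSetoid s).comap H.collapse from hle hpq
  -- Along an edge either the collapse does not change the circle of a point, or the edge is
  -- internal to a ladder and both its ends collapse to the same point.
  have key : ∀ p : CrossingEnd D.n, D.circleSetoid s (H.collapse (Sum.inl p)) (Sum.inl p) ∨
      H.collapse (Sum.inl p) = H.collapse (Sum.inl (D.edge p)) := by
    rintro ⟨x, e⟩
    rcases H.step_or_B x with ⟨i, a, rfl⟩ | hx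
    · rw [H.eq_stepEnd]
      generalize e - H.dir i a = e
      obtain ⟨b, hb⟩ := hred i
      obtain ⟨m, hm, hm'⟩ := H.exists_first_red hb
      obtain ⟨l, hl, hl'⟩ := H.exists_last_red hb
      have h3 := H.outerPt_other hm hm'
      have h1 := (H.endPt_max_all hl hl').2
      have he : (e = 0 ∨ e = 1) ∨ (e = 2 ∨ e = 3) := by revert e; decide
      rcases he with he | he
      · rcases (H.le_lastIdx i a).eq_or_lt with rfl | hlt
        · left
          change D.circleSetoid s (H.collapse (H.stepPt i _ e)) (H.stepPt i _ e)
          rw [H.collapse_stepPt]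
          rcases he with rfl | rfl <;> simp only [Fin.reduceEq, or_false, and_false, if_false]
          · exact rf _
          · exact h1
        · right
          have hlt' : (a : ℕ) + 1 < h i :=
            lt_of_le_of_lt (Nat.succ_le_of_lt hlt) (H.lastIdx i).2
          have hne : (⟨(a : ℕ) + 1, hlt'⟩ : Fin (h i)) ≠ H.firstIdx i := by
            simp [firstIdx]
          rcases he with rfl | rfl
          · rw [H.edge_zero (b := ⟨a + 1, hlt'⟩) rfl]
            change H.collapse (H.stepPt i _ _) = H.collapse (H.stepPt i _ _)
            rw [H.collapse_stepPt, H.collapse_stepPt]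
            simp [hne]
          · rw [H.edge_one (b := ⟨a + 1, hlt'⟩) rfl]
            change H.collapse (H.stepPt i _ _) = H.collapse (H.stepPt i _ _)
            rw [H.collapse_stepPt, H.collapse_stepPt]
            simp [hne]
      · rcases (H.firstIdx_le i a).eq_or_lt with rfl | hlt
        · left
          change D.circleSetoid s (H.collapse (H.stepPt i _ e)) (H.stepPt i _ e)
          rw [H.collapse_stepPt, if_pos ⟨rfl, he⟩]
          rcases he with rfl | rfl
          · exact rf _
          · exact h3
        · right
          have hne : a ≠ H.firstIdx i := hlt.ne'
          have hpos : 0 < (a : ℕ) := Fin.lt_def.1 hlt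
          have hlt' : (a : ℕ) - 1 < h i := by omega
          have h5 : ((⟨(a : ℕ) - 1, hlt'⟩ : Fin (h i)) : ℕ) + 1 = a := by
            change (a : ℕ) - 1 + 1 = a; omega
          rcases he with rfl | rfl
          · rw [← H.edge_one h5, D.edge_edge, H.edge_one h5]
            change H.collapse (H.stepPt i _ _) = H.collapse (H.stepPt i _ _)
            rw [H.collapse_stepPt, H.collapse_stepPt]
            simp [hne]
          · rw [← H.edge_zero h5, D.edge_edge, H.edge_zero h5]
            change H.collapse (H.stepPt i _ _) = H.collapse (H.stepPt i _ _)
            rw [H.collapse_stepPt, H.collapse_stepPt]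
            simp [hne]
    · left
      rw [H.collapse_of_B hx]
  refine circleSetoid_le (fun p => ?_) (fun p => ?_)
  · change D.circleSetoid s (H.collapse _) (H.collapse _)
    rcases key p with h1 | h1
    · rcases key (D.edge p) with h2 | h2
      · exact tr h1 (tr (circleSetoid_edge s p) (sy h2))
      · rw [h2, D.edge_edge]
    · rw [h1]
  · change D.circleSetoid s (H.collapse _) (H.collapse _)
    obtain ⟨x, e⟩ := p
    rcases H.step_or_B x with ⟨i, a, rfl⟩ | hx
    · rw [H.eq_stepEnd]
      generalize e - H.dir i a = e
      by_cases ha : a = H.firstIdx i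
      · rw [H.smooth_B ((H.brokenState_step i a).2 ha)]
        change D.circleSetoid s (H.collapse (H.stepPt i _ _)) (H.collapse (H.stepPt i _ _))
        rw [H.collapse_stepPt, H.collapse_stepPt]
        -- The broken state is red at the first step, so its arcs there keep back and front apart,
        -- as does `collapse`.
        have : (![1, 0, 3, 2] e = (2 : Fin 4) ∨ ![1, 0, 3, 2] e = (3 : Fin 4)) ↔
          (e = 2 ∨ e = 3) := by revert e; decide
        simp only [this]
        exact rf _
      · obtain ⟨e', he'⟩ := H.smooth_stepEnd_eq H.brokenState i a e
        rw [he']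
        change D.circleSetoid s (H.collapse (H.stepPt i _ _)) (H.collapse (H.stepPt i _ _))
        rw [H.collapse_stepPt, H.collapse_stepPt, if_neg (fun h => ha h.1),
          if_neg (fun h => ha h.1)]
    · have h1 : D.smooth H.brokenState (x, e) = D.smooth s (x, e) :=
        smooth_congr (by rw [hs x hx, H.brokenState_of_B hx])
      have h2 : D.smooth s (x, e) = (x, (D.smooth s (x, e)).2) :=
        Prod.ext (smooth_fst s (x, e)) rfl
      rw [h1, h2, H.collapse_of_B hx, H.collapse_of_B hx, ← h2]
      exact circleSetoid_smooth s _

/-- The two extremes share a circle of the broken state, and moving red scars within the ladders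
does not change how the extremes are joined outside them. One red step in each ladder suffices. -/
theorem outerPt_endPt {i : Fin k} (hp : H.peripheryNumber i = 1) {s : D.KState}
    (hs : ∀ x, s₀ x = .B → s x = .B) (hred : ∀ i, ∃ a, s (H.step i a) = .B) :
    D.circleSetoid s (H.outerPt i) (H.endPt i) := by
  have := H.collapse_related hs hred (H.brokenState_front_back hp)
  rw [H.collapse_stepPt, H.collapse_stepPt] at this
  simpa using this

theorem collapse_stepPt_outerPt {i : Fin k} (hp : H.peripheryNumber i = 1) {s : D.KState}
    (hs : ∀ x, s₀ x = .B → s x = .B) (hred : ∀ i, ∃ a, s (H.step i a) = .B)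
    (a : Fin (h i)) (e : Fin 4) :
    D.circleSetoid s (H.collapse (H.stepPt i a e)) (H.outerPt i) := by
  rw [H.collapse_stepPt]
  split_ifs
  · exact (D.circleSetoid s).refl' _
  · exact (D.circleSetoid s).symm' (H.outerPt_endPt hp hs hred)

end LadderSystem

end LinkDiagram

/-! ### An alternating telescoping sum -/

theorem Finset.sum_neg_one_pow_telescope {α N : Type*} [LinearOrder α] [AddCommGroup N]
    (F : Finset α) (u v : α → N)
    (huv : ∀ a ∈ F, ∀ b ∈ F, a < b → (∀ c ∈ F, a < c → ¬ c < b) → v a = u b)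
    {m l : α} (hm : m ∈ F) (hml : ∀ c ∈ F, m ≤ c) (hl : l ∈ F) (hll : ∀ c ∈ F, c ≤ l) :
    ∑ a ∈ F, (-1 : ℤ) ^ (F.filter fun b => b < a).card • (u a + v a) =
      u m + (-1 : ℤ) ^ (F.card + 1) • v l := by
  induction F using Finset.induction_on_max generalizing l with
  | empty => simp at hm
  | insert b F hb ih =>
    have hbF : b ∉ F := fun h => lt_irrefl b (hb b h)
    obtain rfl : l = b := by
      rcases Finset.mem_insert.1 hl with h | h
      · exact h
      · exact absurd (hll b (Finset.mem_insert_self _ _)) (not_le.2 (hb l h))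
    rw [Finset.sum_insert hbF, Finset.card_insert_of_notMem hbF]
    have h1 : (insert l F).filter (fun c => c < l) = F := by
      ext c
      simp only [Finset.mem_filter, Finset.mem_insert]
      constructor
      · rintro ⟨rfl | h, h'⟩
        · exact absurd h' (lt_irrefl _)
        · exact h
      · exact fun h => ⟨Or.inr h, hb c h⟩
    have h2 : ∀ a ∈ F, (insert l F).filter (fun c => c < a) = F.filter fun c => c < a := by
      intro a ha
      rw [Finset.filter_insert, if_neg (not_lt.2 (hb a ha).le)]
    rw [h1, Finset.sum_congr rfl fun a ha => by rw [h2 a ha]]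
    rcases F.eq_empty_or_nonempty with rfl | hF
    · obtain rfl : m = l := by simpa using hm
      simp
    · obtain ⟨l', hl', hll'⟩ : ∃ l' ∈ F, ∀ c ∈ F, c ≤ l' :=
        ⟨_, F.max'_mem hF, fun c hc => F.le_max' c hc⟩
      have hm' : m ∈ F := by
        rcases Finset.mem_insert.1 hm with rfl | h
        · exact absurd (hml l' (Finset.mem_insert_of_mem hl')) (not_le.2 (hb l' hl'))
        · exact h
      have ih' := ih (fun a ha c hc hac hh => huv a (Finset.mem_insert_of_mem ha) c
          (Finset.mem_insert_of_mem hc) hac fun e he hae hec => by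
            rcases Finset.mem_insert.1 he with rfl | he
            · exact lt_asymm hec (hb c hc)
            · exact hh e he hae hec)
        hm' (fun c hc => hml c (Finset.mem_insert_of_mem hc)) hl' hll'
      -- The old maximum `l'` and the added maximum `l` are consecutive, so the two inner terms
      -- agree and cancel by their signs.
      have hvu : v l' = u l := huv l' (Finset.mem_insert_of_mem hl') l
        (Finset.mem_insert_self _ _) (hb l' hl') fun e he hae hel => by
          rcases Finset.mem_insert.1 he with rfl | he
          · exact lt_irrefl _ hel
          · exact not_lt.2 (hll' e he) hae
      rw [ih', hvu]
      simp only [pow_succ, smul_add, mul_neg, mul_one, neg_neg, neg_smul]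
      abel

/-! ### The differential on sums over choices of red steps -/

namespace LinkDiagram

namespace LadderSystem

variable {D : LinkDiagram} {s₀ : D.KState} {k : ℕ} {h : Fin k → ℕ} (H : LadderSystem D s₀ h)

/-- A family of Kauffman states with prescribed red steps, constant off the ladders, whose
ladders have periphery number one. -/
structure IsFamily (st : ((i : Fin k) → Finset (Fin (h i))) → D.KState) : Prop where
  step : ∀ M i a, st M (H.step i a) = .B ↔ a ∈ M i
  rest : ∀ M M' x, s₀ x = .B → st M x = st M' x
  outer : ∀ M, (∀ i, (M i).Nonempty) → ∀ i, D.circleSetoid (st M) (H.outerPt i) (H.endPt i)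

open Classical in
/-- The tuples of sets of steps with prescribed cardinalities. -/
noncomputable def stepSets (h η : Fin k → ℕ) : Finset ((i : Fin k) → Finset (Fin (h i))) :=
  Finset.univ.filter fun M => ∀ j, (M j).card = η j

theorem mem_stepSets {η : Fin k → ℕ} {M : (i : Fin k) → Finset (Fin (h i))} :
    M ∈ stepSets h η ↔ ∀ j, (M j).card = η j := by
  simp [stepSets]

/-- This disposes of ladders that are already entirely red: raising their number of red steps leaves
an empty sum. -/
theorem stepSets_eq_empty {η : Fin k → ℕ} {i : Fin k} (hi : h i < η i) : stepSets h η = ∅ := by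
  rw [Finset.eq_empty_iff_forall_notMem]
  intro M hM
  have h1 := (mem_stepSets.1 hM) i
  have h2 := Finset.card_le_univ (M i)
  rw [Fintype.card_fin] at h2
  omega

theorem step_lt_iff {i j : Fin k} {a : Fin (h i)} {b : Fin (h j)} :
    H.step j b < H.step i a ↔ j < i ∨ ∃ e : j = i, e ▸ b < a := by
  constructor
  · intro hlt
    rcases lt_trichotomy j i with hij | rfl | hij
    · exact Or.inl hij
    · refine Or.inr ⟨rfl, ?_⟩
      by_contra hba
      rcases (not_lt.1 hba).eq_or_lt with he | hab
      · rw [he] at hlt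
        exact lt_irrefl _ hlt
      · exact lt_asymm hlt (H.order_steps j a b hab)
    · exact absurd hlt (lt_asymm (H.order_ladders i j hij a b))
  · rintro (hij | ⟨rfl, hab⟩)
    · exact H.order_ladders j i hij b a
    · exact H.order_steps j b a hab

/-- Sums over the crossings are sums over the steps and the remaining crossings. -/
theorem sum_crossings {N : Type*} [AddCommMonoid N] (f : Fin D.n → N) :
    ∑ x, f x = ∑ i, ∑ a, f (H.step i a) + ∑ x ∈ Finset.univ.filter (fun x => s₀ x = .B), f x := by
  classical
  rw [← Finset.sum_filter_not_add_sum_filter Finset.univ (fun x => s₀ x = .B) f]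
  congr 1
  rw [Finset.sum_filter, ← Fintype.sum_sigma' (fun i a => f (H.step i a))]
  symm
  refine Fintype.sum_of_injective (fun q : Σ i, Fin (h i) => H.step q.1 q.2)
    (fun q r hqr => H.step_eq_iff.1 hqr) _ _ (fun x hx => ?_) fun q => ?_
  · rw [if_neg]
    rw [not_not]
    rcases H.step_or_B x with ⟨i, a, rfl⟩ | hB
    · exact absurd ⟨⟨i, a⟩, rfl⟩ hx
    · exact hB
  · rw [if_pos]
    rw [H.step_blue]
    decide

variable {H} {st : ((i : Fin k) → Finset (Fin (h i))) → D.KState}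

/-- The numbering puts earlier ladders first and the remaining crossings last. Only earlier ladders
and earlier steps of the same ladder count, whatever the labels off the ladders. -/
theorem IsFamily.changeSign_step (hst : H.IsFamily st) (M : (i : Fin k) → Finset (Fin (h i)))
    (t : Fin k) (a : Fin (h t)) : changeSign (st M) (H.step t a) =
      (-1) ^ (∑ j ∈ Finset.univ.filter (fun j => j < t), (M j).card) *
      (-1) ^ ((M t).filter fun b => b < a).card := by
  classical
  unfold changeSign
  rw [← pow_add]
  congr 1
  rw [Finset.card_filter, H.sum_crossings, Finset.sum_eq_zero (s := Finset.filter _ _), add_zero,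
    Finset.sum_filter]
  · have hsum : ((M t).filter fun b => b < a).card =
        ∑ j, if j = t then ((M t).filter fun b => b < a).card else 0 := by simp
    rw [hsum, ← Finset.sum_add_distrib]
    refine Finset.sum_congr rfl fun j _ => ?_
    rw [← Finset.card_filter]
    rcases lt_trichotomy j t with hj | rfl | hj
    · rw [if_pos hj, if_neg hj.ne, add_zero]
      congr 1
      ext b
      simp [hst.step, H.order_ladders j t hj b a]
    · rw [if_neg (lt_irrefl _), if_pos rfl, zero_add]
      congr 1
      ext b
      simp only [Finset.mem_filter, Finset.mem_univ, true_and, hst.step, H.step_lt_iff, lt_irrefl,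
        false_or, exists_const]
      exact and_comm
    · rw [if_neg hj.not_gt, if_neg hj.ne', add_zero, Finset.card_eq_zero,
        Finset.filter_eq_empty_iff]
      rintro b - ⟨hlt, -⟩
      exact lt_asymm hlt (H.order_ladders t j hj a b)
  · intro x hx
    rw [if_neg]
    rintro ⟨hlt, -⟩
    exact lt_asymm hlt (H.order_rest x (Finset.mem_filter.1 hx).2 t a)

/-- Labels off the ladders are independent of the chosen steps, so reddening one step stays inside
the family. -/
theorem IsFamily.update_insert (hst : H.IsFamily st) (M : (i : Fin k) → Finset (Fin (h i)))
    (t : Fin k) (a : Fin (h t)) :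
    st (Function.update M t (insert a (M t))) = Function.update (st M) (H.step t a) .B := by
  classical
  have key : ∀ l l' : SmoothingLabel, (l = .B ↔ l' = .B) → l = l' := by
    intro l l'
    cases l <;> cases l' <;> simp
  funext x
  rcases H.step_or_B x with ⟨i, b, rfl⟩ | hx
  · refine key _ _ ?_
    rw [hst.step]
    by_cases hi : i = t
    · subst hi
      by_cases hb : b = a
      · subst hb; simp
      · have hne : H.step i b ≠ H.step i a := fun h => hb (H.step_inj.1 h)
        simp [hb, hne, hst.step]
    · have hne : H.step i b ≠ H.step t a := fun h =>
        hi (congrArg Sigma.fst (H.step_eq_iff.1 h))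
      simp [hi, hne, hst.step]
  · rw [Function.update_of_ne (H.ne_step_of_B hx t a).symm]
    exact hst.rest _ _ x hx

variable {N : Type*} [AddCommGroup N]

theorem add_one_three (G : D.Pt → N) (t : Fin k) (a : Fin (h t)) :
    G (Sum.inl (H.step t a, 1)) + G (Sum.inl (H.step t a, 3)) =
      G (H.stepPt t a 2) + G (H.stepPt t a 0) := by
  unfold stepPt stepEnd
  rcases H.dir_eq t a with hd | hd <;> rw [hd]
  · exact add_comm _ _
  · rfl

/-- The alternating sum over the red steps of a ladder telescopes. -/
theorem IsFamily.sum_ladder (hst : H.IsFamily st) {M : (i : Fin k) → Finset (Fin (h i))}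
    (hM : ∀ i, (M i).Nonempty) (G : D.Pt → N)
    (hG : ∀ p q, D.circleSetoid (st M) p q → G p = G q) (t : Fin k) :
    ∑ a ∈ M t, (-1 : ℤ) ^ ((M t).filter fun b => b < a).card •
        (G (Sum.inl (H.step t a, 1)) + G (Sum.inl (H.step t a, 3))) =
      (1 + (-1 : ℤ) ^ ((M t).card + 1)) • G (H.outerPt t) := by
  have hA : ∀ {c}, c ∉ M t → st M (H.step t c) = .A := by
    intro c hc
    cases hs : st M (H.step t c)
    · rfl
    · exact absurd ((hst.step M t c).1 hs) hc
  have hB : ∀ {c}, c ∈ M t → st M (H.step t c) = .B := fun hc => (hst.step M t _).2 hc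
  have hmin := (M t).min'_mem (hM t)
  have hmax := (M t).max'_mem (hM t)
  simp only [add_one_three]
  rw [Finset.sum_neg_one_pow_telescope (M t) (fun a => G (H.stepPt t a 2))
    (fun a => G (H.stepPt t a 0)) ?_ hmin (fun c hc => (M t).min'_le c hc) hmax
    (fun c hc => (M t).le_max' c hc)]
  · have h1 : G (H.outerPt t) = G (H.stepPt t ((M t).min' (hM t)) 2) :=
      hG _ _ (H.outerPt_min fun c hc => hA fun h => not_le.2 hc ((M t).min'_le c h))
    have h2 : G (H.endPt t) = G (H.stepPt t ((M t).max' (hM t)) 0) :=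
      hG _ _ (H.endPt_max_all (hB hmax) fun c hc => hA fun h =>
        not_le.2 hc ((M t).le_max' c h)).1
    -- Both outer terms of the telescope belong to the same circle; without periphery number one
    -- they could not be combined.
    rw [← h1, ← h2, ← hG _ _ (hst.outer M hM t), add_smul, one_smul]
  · intro a ha b hb hab hc
    exact hG _ _ (H.front_back hab (hB hb) fun c h1 h2 => hA fun h => hc c h h1 h2)

/-- Adding a step to a set is reindexed as marking a step of the larger set, which groups the
contributions by target state. For each target `sum_ladder` applies with `η t + 1` red steps, whence
the sign (-1)^(η t). -/
theorem IsFamily.sum_steps (hst : H.IsFamily st) (G : D.KState → D.Pt → N)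
    (hG : ∀ s p q, D.circleSetoid s p q → G s p = G s q) {η : Fin k → ℕ} (hη : ∀ i, 1 ≤ η i)
    (t : Fin k) :
    ∑ M ∈ stepSets h η, ∑ a ∈ Finset.univ.filter (fun a => a ∉ M t),
      changeSign (st M) (H.step t a) •
        (G (Function.update (st M) (H.step t a) .B) (Sum.inl (H.step t a, 1)) +
         G (Function.update (st M) (H.step t a) .B) (Sum.inl (H.step t a, 3))) =
    ((-1 : ℤ) ^ (∑ j ∈ Finset.univ.filter (fun j => j < t), η j) * (1 + (-1 : ℤ) ^ (η t))) •
      ∑ M ∈ stepSets h (Function.update η t (η t + 1)), G (st M) (H.outerPt t) := by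
  classical
  have hreindex : ∑ M ∈ stepSets h η, ∑ a ∈ Finset.univ.filter (fun a => a ∉ M t),
      changeSign (st M) (H.step t a) •
        (G (Function.update (st M) (H.step t a) .B) (Sum.inl (H.step t a, 1)) +
         G (Function.update (st M) (H.step t a) .B) (Sum.inl (H.step t a, 3))) =
      ∑ M ∈ stepSets h (Function.update η t (η t + 1)), ∑ a ∈ M t,
        ((-1 : ℤ) ^ (∑ j ∈ Finset.univ.filter (fun j => j < t), η j) *
        (-1 : ℤ) ^ ((M t).filter fun b => b < a).card) •
        (G (st M) (Sum.inl (H.step t a, 1)) + G (st M) (Sum.inl (H.step t a, 3))) := by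
    -- The pairs (set, new step) correspond to (enlarged set, marked step), inserting in one
    -- direction and erasing in the other.
    rw [Finset.sum_sigma', Finset.sum_sigma']
    refine Finset.sum_bij'
      (fun q _ => ⟨Function.update q.1 t (insert q.2 (q.1 t)), q.2⟩)
      (fun q _ => ⟨Function.update q.1 t ((q.1 t).erase q.2), q.2⟩) ?_ ?_ ?_ ?_ ?_
    · rintro ⟨M, a⟩ hq
      simp only [Finset.mem_sigma, mem_stepSets, Finset.mem_filter, Finset.mem_univ,
        true_and] at hq ⊢
      refine ⟨fun j => ?_, by simp⟩
      by_cases hj : j = t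
      · subst hj
        simp [Finset.card_insert_of_notMem hq.2, hq.1]
      · simp [hj, hq.1]
    · rintro ⟨M, a⟩ hq
      simp only [Finset.mem_sigma, mem_stepSets, Finset.mem_filter, Finset.mem_univ,
        true_and] at hq ⊢
      refine ⟨fun j => ?_, by simp⟩
      by_cases hj : j = t
      · subst hj
        have := hq.1 j
        simp only [Function.update_self] at this ⊢
        rw [Finset.card_erase_of_mem hq.2, this, Nat.add_sub_cancel]
      · have := hq.1 j
        simpa [hj] using this
    · rintro ⟨M, a⟩ hq
      simp only [Finset.mem_sigma, Finset.mem_filter] at hq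
      simp [Finset.erase_insert hq.2.2]
    · rintro ⟨M, a⟩ hq
      simp only [Finset.mem_sigma] at hq
      simp [Finset.insert_erase hq.2]
    · rintro ⟨M, a⟩ hq
      simp only [Finset.mem_sigma, mem_stepSets, Finset.mem_filter, Finset.mem_univ,
        true_and] at hq
      dsimp only
      rw [hst.update_insert, hst.changeSign_step, Finset.sum_congr rfl fun j _ => hq.1 j,
        Function.update_self, Finset.filter_insert, if_neg (lt_irrefl a)]
  rw [hreindex, Finset.smul_sum]
  refine Finset.sum_congr rfl fun M hM => ?_
  rw [mem_stepSets] at hM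
  have hne : ∀ i, (M i).Nonempty := by
    intro i
    rw [← Finset.card_pos, hM i]
    by_cases hi : i = t
    · subst hi; simp
    · simpa [hi] using Nat.lt_of_succ_le (hη i)
  have hcard : (M t).card = η t + 1 := by simpa using hM t
  simp only [mul_smul]
  rw [← Finset.smul_sum, hst.sum_ladder hne (G (st M)) (hG _) t, hcard, pow_succ, pow_succ]
  simp

/-- The differential of a sum over the states of a family. -/
theorem IsFamily.d_sum (hst : H.IsFamily st)
    (S : ((i : Fin k) → Finset (Fin (h i))) → D.EState) (hS : ∀ M, (S M).1 = st M)
    (G : D.KState → D.Pt → D.Chain) (hG : ∀ s p q, D.circleSetoid s p q → G s p = G s q)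
    (hSG : ∀ M x, st M x = .A → D.IsBichord (Function.update (st M) x .B) x →
      adjacentSum x (S M) = G (Function.update (st M) x .B) (Sum.inl (x, 1)) +
        G (Function.update (st M) x .B) (Sum.inl (x, 3)))
    {η : Fin k → ℕ} (hη : ∀ i, 1 ≤ η i) :
    D.d (∑ M ∈ stepSets h η, Finsupp.single (S M) 1) =
      ∑ t, ((-1 : ℤ) ^ (∑ j ∈ Finset.univ.filter (fun j => j < t), η j) *
          (1 + (-1 : ℤ) ^ (η t))) •
        ∑ M ∈ stepSets h (Function.update η t (η t + 1)), G (st M) (H.outerPt t) +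
      ∑ M ∈ stepSets h η, ∑ x ∈ Finset.univ.filter (fun x => s₀ x = .B),
        changeSign (st M) x • adjacentSum x (S M) := by
  rw [map_sum]
  simp only [d_single, H.sum_crossings, Finset.sum_add_distrib]
  congr 1
  · rw [Finset.sum_comm]
    refine Finset.sum_congr rfl fun t _ => ?_
    rw [← hst.sum_steps G hG hη t]
    refine Finset.sum_congr rfl fun M hM => ?_
    rw [Finset.sum_filter]
    refine Finset.sum_congr rfl fun a _ => ?_
    rw [hS]
    by_cases ha : a ∉ M t
    · rw [if_pos ha]
      have hA : st M (H.step t a) = .A := by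
        cases hs : st M (H.step t a)
        · rfl
        · exact absurd ((hst.step M t a).1 hs) ha
      rw [hSG M _ hA]
      have hpos : (M t).Nonempty := by
        rw [← Finset.card_pos, mem_stepSets.1 hM t]
        exact hη t
      obtain ⟨c, hc⟩ := hpos
      have hca : a ≠ c := fun h => ha (h ▸ hc)
      -- Since `η t ≥ 1`, the new red step has an older red step `c` as companion.
      refine H.isBichord_of_two_red hca (by simp) ?_
      rw [Function.update_of_ne (fun h => hca (H.step_inj.1 h).symm), hst.step]
      exact hc
    · rw [if_neg ha, adjacentSum_of_B, smul_zero]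
      rw [hS, hst.step]
      exact not_not.1 ha
  · simp only [hS]

end LadderSystem

end LinkDiagram

/-! ### Arithmetic of the exceptional pairs -/

/-- An even, non-maximal coordinate t₁ of μ gives a partner t₂ with μ + e(t₁) = μ' + e(t₂), where
e(t) is the unit vector; t₁ = t₂ would make the tuples equal. This one identity determines
everything except the condition at the other ladders, which comes from applying the matching a
second time. -/
theorem ExceptionalPair.of_forall_update_eq {k : ℕ} {h μ μ' : Fin k → ℕ} (hμ : ∀ i, μ i ≤ h i)
    (hne : μ ≠ μ') (hex : ∃ r, Even (μ r) ∧ μ r < h r)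
    (hall : ∀ i, Even (μ i) → μ i < h i → ∃ i', Even (μ' i') ∧
      Function.update μ i (μ i + 1) = Function.update μ' i' (μ' i' + 1)) :
    ExceptionalPair h μ μ' := by
  obtain ⟨t₁, he₁, hlt₁⟩ := hex
  obtain ⟨t₂, he₂, heq⟩ := hall t₁ he₁ hlt₁
  have h12 : t₁ ≠ t₂ := by
    rintro rfl
    refine hne (funext fun j => ?_)
    have := congrFun heq j
    by_cases hj : j = t₁
    · subst hj; simpa using this
    · simpa [hj] using this
  have h1 : μ t₁ + 1 = μ' t₁ := by simpa [h12] using congrFun heq t₁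
  have h2 : μ t₂ = μ' t₂ + 1 := by simpa [h12.symm] using congrFun heq t₂
  have h3 : ∀ t, t ≠ t₁ → t ≠ t₂ → μ t = μ' t := fun t ht1 ht2 => by
    simpa [ht1, ht2] using congrFun heq t
  refine ⟨?_, t₁, t₂, ⟨by omega, by omega, h3⟩, fun t ht1 ht2 => ?_, he₁, hlt₁, ?_, h1.symm,
    by omega⟩
  · have hs := congrArg (fun f : Fin k → ℕ => ∑ j, f j) heq
    simp only [Finset.sum_update_of_mem (Finset.mem_univ _)] at hs
    have e1 := Finset.add_sum_erase Finset.univ μ (Finset.mem_univ t₁)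
    have e2 := Finset.add_sum_erase Finset.univ μ' (Finset.mem_univ t₂)
    rw [Finset.sdiff_singleton_eq_erase, Finset.sdiff_singleton_eq_erase] at hs
    omega
  · by_contra hcon
    rw [not_or, Nat.not_odd_iff_even] at hcon
    obtain ⟨i', -, heq'⟩ := hall t hcon.1 (lt_of_le_of_ne (hμ t) hcon.2)
    -- At t₁ this gives μ t₁ ≥ μ' t₁, against μ' t₁ = μ t₁ + 1.
    have h4 := congrFun heq' t₁
    rw [Function.update_of_ne ht1.symm, Function.update_apply] at h4
    split_ifs at h4 with hi
    · subst hi; omega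
    · omega
  · rw [h2]
    exact he₂.add_one

/-! ### The chains V(μ) as cycles, and their 2-torsion -/

namespace LinkDiagram

theorem homologyClass_eq_iff {D : LinkDiagram} {Z Z' : D.Chain} (hZ : Z ∈ LinearMap.ker D.d)
    (hZ' : Z' ∈ LinearMap.ker D.d) :
    D.homologyClass Z hZ = D.homologyClass Z' hZ' ↔ Z - Z' ∈ LinearMap.range D.d :=
  Submodule.Quotient.eq _

namespace LadderSystem

variable {D : LinkDiagram} {s₀ : D.KState} {k : ℕ} {h : Fin k → ℕ} {H : LadderSystem D s₀ h}

theorem isFamily_stateOf (hp : ∀ i, H.peripheryNumber i = 1) : H.IsFamily H.stateOf where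
  step M i a := H.stateOf_step M i a
  rest M M' x hx := by rw [H.stateOf_of_B M hx, H.stateOf_of_B M' hx]
  outer M hM i := H.outerPt_endPt (hp i) (fun x hx => H.stateOf_of_B M hx) fun j =>
    ⟨(hM j).choose, (H.stateOf_step M j _).2 (hM j).choose_spec⟩

/-- Circles of `stateOf M` are contained in circles of the broken state, so ends on distinct circles
there stay on distinct circles. -/
theorem isBichord_stateOf (hp : ∀ i, H.peripheryNumber i = 1) {x : Fin D.n}
    (hb : D.IsBichord H.brokenState x) (M : (i : Fin k) → Finset (Fin (h i))) :
    D.IsBichord (H.stateOf M) x := fun hcon =>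
  hb (Quotient.sound (H.circleSetoid_le_brokenState hp (fun _ hy => H.stateOf_of_B M hy)
    (Quotient.exact hcon)))

theorem update_update_stateOf {x : Fin D.n} (hx : s₀ x = .B)
    (M : (i : Fin k) → Finset (Fin (h i))) :
    Function.update (Function.update (H.stateOf M) x .A) x .B = H.stateOf M := by
  rw [Function.update_idem, ← H.stateOf_of_B M hx, Function.update_eq_self]

/-- Making one red bichord off the ladders blue merges two circles. Steps are untouched, and
extremes on a common circle remain on one. -/
theorem isFamily_update (hp : ∀ i, H.peripheryNumber i = 1) {x : Fin D.n} (hx : s₀ x = .B)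
    (hb : D.IsBichord H.brokenState x) :
    H.IsFamily fun M => Function.update (H.stateOf M) x .A where
  step M i a := by
    rw [Function.update_of_ne (H.ne_step_of_B hx i a), H.stateOf_step]
  rest M M' y hy := by
    by_cases hyx : y = x
    · subst hyx; simp
    · simp [hyx, H.stateOf_of_B M hy, H.stateOf_of_B M' hy]
  outer M hM i := by
    have hb' := isBichord_stateOf hp hb M
    rw [← update_update_stateOf hx M] at hb'
    refine circleSetoid_update_le hb' ?_
    rw [update_update_stateOf hx M]
    exact (isFamily_stateOf hp).outer M hM i

theorem minusChain_eq (η : Fin k → ℕ) (i : Fin k) :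
    H.minusChain η i = ∑ M ∈ stepSets h η, minusState (H.stateOf M) (H.outerPt i) := rfl

theorem minusChain_eq_zero {η : Fin k → ℕ} {i j : Fin k} (hj : h j < η j) :
    H.minusChain η i = 0 := by
  rw [minusChain_eq, stepSets_eq_empty hj, Finset.sum_empty]

theorem sum_rest_stateOf (M : (i : Fin k) → Finset (Fin (h i))) (S : D.EState)
    (hS : S.1 = H.stateOf M) :
    ∑ x ∈ Finset.univ.filter (fun x => s₀ x = .B),
      changeSign (H.stateOf M) x • adjacentSum x S = 0 := by
  refine Finset.sum_eq_zero fun x hx => ?_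
  rw [adjacentSum_of_B, smul_zero]
  rw [hS, H.stateOf_of_B M (Finset.mem_filter.1 hx).2]

theorem d_plusState (hp : ∀ i, H.peripheryNumber i = 1) {η : Fin k → ℕ} (hη : ∀ i, 1 ≤ η i) :
    D.d (∑ M ∈ stepSets h η, plusState (H.stateOf M)) =
      ∑ t, ((-1 : ℤ) ^ (∑ j ∈ Finset.univ.filter (fun j => j < t), η j) *
          (1 + (-1 : ℤ) ^ (η t))) • H.minusChain (Function.update η t (η t + 1)) t := by
  have := (isFamily_stateOf hp).d_sum (fun M => ⟨H.stateOf M, fun _ => 1⟩) (fun _ => rfl)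
    minusState (fun _ _ _ => minusState_congr) (fun M x hx hb => adjacentSum_plus hx hb) hη
  rw [Finset.sum_eq_zero (fun M _ => sum_rest_stateOf M _ rfl), add_zero] at this
  exact this

theorem d_minusChain (hp : ∀ i, H.peripheryNumber i = 1) {η : Fin k → ℕ} (hη : ∀ i, 1 ≤ η i)
    (i : Fin k) :
    D.d (H.minusChain η i) =
      ∑ t, ((-1 : ℤ) ^ (∑ j ∈ Finset.univ.filter (fun j => j < t), η j) *
          (1 + (-1 : ℤ) ^ (η t))) • ∑ M ∈ stepSets h (Function.update η t (η t + 1)),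
            twoMinusState (H.stateOf M) (H.outerPt i) (H.outerPt t) := by
  classical
  have := (isFamily_stateOf hp).d_sum
    (fun M => ⟨H.stateOf M, fun c => if c = Quotient.mk _ (H.outerPt i) then -1 else 1⟩)
    (fun _ => rfl) (fun s q => twoMinusState s (H.outerPt i) q)
    (fun _ _ _ => twoMinusState_congr) (fun M x hx hb => adjacentSum_minus hx hb (H.outerPt i) _
      fun q => by rw [← mk_eq_mk_iff]; split_ifs with h <;> simp [h]) hη
  rw [Finset.sum_eq_zero (fun M _ => sum_rest_stateOf M _ rfl), add_zero] at this
  rw [minusChain_eq]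
  convert this using 3
  unfold minusState
  congr!

/-- Twice `V μ` is a boundary. -/
theorem d_plusState_eq_two_smul_V (hp : ∀ i, H.peripheryNumber i = 1) {μ : Fin k → ℕ}
    (hμ : ∀ i, 1 ≤ μ i ∧ μ i ≤ h i) :
    D.d (∑ M ∈ stepSets h μ, plusState (H.stateOf M)) = (2 : ℤ) • H.V μ := by
  rw [d_plusState hp fun i => (hμ i).1]
  unfold V
  rw [Finset.smul_sum, Finset.sum_filter]
  refine Finset.sum_congr rfl fun t _ => ?_
  split_ifs with ht
  · rw [ht.1.neg_one_pow, smul_smul, mul_comm]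
    norm_num
  · rcases Nat.even_or_odd (μ t) with he | ho
    -- Here μ t is even but maximal: the coefficient is 2, and the chain itself is zero.
    · have : h t < Function.update μ t (μ t + 1) t := by
        have := (hμ t).2
        have := not_lt.1 fun hlt => ht ⟨he, hlt⟩
        simp only [Function.update_self]
        omega
      rw [minusChain_eq_zero this, smul_zero]
    · rw [ho.neg_one_pow]
      simp

theorem sum_lt_update (μ : Fin k → ℕ) (i t : Fin k) :
    ∑ j ∈ Finset.univ.filter (fun j => j < t), Function.update μ i (μ i + 1) j =
      ∑ j ∈ Finset.univ.filter (fun j => j < t), μ j + if i < t then 1 else 0 := by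
  classical
  have : ∀ j, Function.update μ i (μ i + 1) j = μ j + if j = i then 1 else 0 := by
    intro j
    by_cases hj : j = i
    · subst hj; simp
    · simp [hj]
  simp only [this, Finset.sum_add_distrib]
  congr 1
  rw [Finset.sum_ite_eq']
  simp

/-- The boundary is a sum over ordered pairs of ladders that each gain a red step, both outer
circles being negative. Exchanging the ladders gives the same chain with opposite sign, and the
diagonal vanishes because its two negative circles coincide. -/
theorem V_mem_ker (hp : ∀ i, H.peripheryNumber i = 1) {μ : Fin k → ℕ}
    (hμ : ∀ i, 1 ≤ μ i ∧ μ i ≤ h i) : H.V μ ∈ LinearMap.ker D.d := by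
  rw [LinearMap.mem_ker]
  let e : Fin k → ℤ := fun i => (-1) ^ (∑ j ∈ Finset.univ.filter (fun j => j < i), μ j)
  let c : Fin k → ℤ := fun i => if Even (μ i) ∧ μ i < h i then 1 else 0
  let Y : Fin k → Fin k → D.Chain := fun i t =>
    ∑ M ∈ stepSets h (Function.update (Function.update μ i (μ i + 1)) t
      (Function.update μ i (μ i + 1) t + 1)),
      twoMinusState (H.stateOf M) (H.outerPt i) (H.outerPt t)
  -- The factor -1 for `i < t` records that the red step already added to the ladder `i` precedes
  -- those of `t`; it makes `F` antisymmetric.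
  let F : Fin k → Fin k → D.Chain := fun i t =>
    (2 * c i * c t * e i * e t * (if i < t then -1 else 1)) • Y i t
  have hYself : ∀ i, Y i i = 0 := fun i =>
    Finset.sum_eq_zero fun M _ => twoMinusState_self _ _
  have hYcomm : ∀ i t, i ≠ t → Y i t = Y t i := by
    intro i t hit
    simp only [Y]
    rw [Function.update_of_ne hit.symm, Function.update_of_ne hit, Function.update_comm hit]
    exact Finset.sum_congr rfl fun M _ => twoMinusState_comm _ _ _
  have hV : D.d (H.V μ) = ∑ i, ∑ t, F i t := by
    unfold V
    rw [map_sum, Finset.sum_filter]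
    refine Finset.sum_congr rfl fun i _ => ?_
    split_ifs with hi
    · have hη : ∀ j, 1 ≤ Function.update μ i (μ i + 1) j := by
        intro j
        by_cases hj : j = i
        · subst hj; simp
        · simpa [hj] using (hμ j).1
      rw [map_smul, d_minusChain hp hη, Finset.smul_sum]
      refine Finset.sum_congr rfl fun t _ => ?_
      change _ • _ • Y i t = _
      rw [smul_smul]
      by_cases hit : t = i
      · subst hit
        simp only [F, hYself, smul_zero]
      · simp only [F]
        rcases Nat.even_or_odd (μ t) with he | ho
        · by_cases hlt : μ t < h t
          · congr 1
            rw [sum_lt_update, Function.update_of_ne hit, he.neg_one_pow, pow_add]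
            simp only [c, if_pos hi, if_pos (And.intro he hlt), e]
            split_ifs <;> ring
          · have : Y i t = 0 := by
              simp only [Y]
              rw [stepSets_eq_empty (i := t), Finset.sum_empty]
              simp only [Function.update_self, Function.update_of_ne hit]
              omega
            rw [this, smul_zero, smul_zero]
        · have hc : c t = 0 := if_neg fun h => Nat.not_even_iff_odd.2 ho h.1
          rw [Function.update_of_ne hit, ho.neg_one_pow, hc]
          simp
    · have hc : c i = 0 := if_neg hi
      simp [F, hc]
  have hanti : ∀ i t, F i t = - F t i := by
    intro i t
    rcases lt_trichotomy i t with hit | rfl | hit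
    · simp only [F]
      rw [hYcomm i t hit.ne, if_pos hit, if_neg hit.not_gt, ← neg_smul]
      congr 1
      ring
    · simp only [F, hYself, smul_zero, neg_zero]
    · simp only [F]
      rw [hYcomm i t hit.ne', if_neg hit.not_gt, if_pos hit, ← neg_smul]
      congr 1
      ring
  -- Exchanging the summation indices turns antisymmetry into equality with the negative; integral
  -- chains have no 2-torsion.
  have hself : D.d (H.V μ) = - D.d (H.V μ) := by
    conv_lhs => rw [hV, Finset.sum_comm]
    rw [hV, ← Finset.sum_neg_distrib]
    refine Finset.sum_congr rfl fun i _ => ?_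
    rw [← Finset.sum_neg_distrib]
    exact Finset.sum_congr rfl fun t _ => hanti t i
  exact self_eq_neg.1 hself

/-! ### Distinguishing homology classes -/

theorem stateOf_injective : Function.Injective H.stateOf := by
  intro M M' hMM
  funext i
  ext a
  rw [← H.stateOf_step M, ← H.stateOf_step M', hMM]

open Classical in
theorem oneMinusParity_minusChain (M : (i : Fin k) → Finset (Fin (h i))) (η : Fin k → ℕ)
    (i : Fin k) : oneMinusParity (H.stateOf M) (H.minusChain η i) =
      if (fun j => (M j).card) = η then 1 else 0 := by
  rw [minusChain_eq, map_sum]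
  simp only [oneMinusParity_minusState, stateOf_injective.eq_iff]
  rw [Finset.sum_ite_eq']
  simp only [mem_stepSets, funext_iff]

open Classical in
theorem oneMinusParity_V (M : (i : Fin k) → Finset (Fin (h i))) (μ : Fin k → ℕ) :
    oneMinusParity (H.stateOf M) (H.V μ) =
      ∑ i ∈ Finset.univ.filter (fun i => Even (μ i) ∧ μ i < h i),
        if (fun j => (M j).card) = Function.update μ i (μ i + 1) then 1 else 0 := by
  unfold V
  rw [map_sum]
  refine Finset.sum_congr rfl fun i _ => ?_
  rw [map_smul, oneMinusParity_minusChain]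
  rcases neg_one_pow_eq_or ℤ (∑ j ∈ Finset.univ.filter (fun j => j < i), μ j) with hc | hc
  · rw [hc, one_smul]
  · rw [hc, neg_smul, one_smul, ZMod.neg_eq_self_mod_two]

/-- Each multi-index in V(μ) is detected by a state realizing it, where the parity of V(μ) is 1. The
parity of V(μ') must then be 1 too, so that multi-index also occurs in V(μ'). -/
theorem exceptionalPair_of_sub_mem_range (hp : ∀ i, H.peripheryNumber i = 1)
    (hb : ∀ x, s₀ x = .B → D.IsBichord H.brokenState x) {μ μ' : Fin k → ℕ}
    (hμ : AdmissibleTuple h μ) (hne : μ ≠ μ') (hmem : H.V μ - H.V μ' ∈ LinearMap.range D.d) :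
    ExceptionalPair h μ μ' := by
  classical
  refine ExceptionalPair.of_forall_update_eq (fun i => (hμ.1 i).2) hne hμ.2 fun i he hlt => ?_
  have hle : ∀ j, 2 ≤ Function.update μ i (μ i + 1) j ∧ Function.update μ i (μ i + 1) j ≤ h j := by
    intro j
    have := hμ.1 j
    by_cases hj : j = i
    · subst hj
      simp only [Function.update_self]
      omega
    · simpa [hj] using this
  have hex : ∀ j, ∃ F : Finset (Fin (h j)), F.card = Function.update μ i (μ i + 1) j := fun j => by
    obtain ⟨F, -, hF⟩ := Finset.exists_subset_card_eq (s := (Finset.univ : Finset (Fin (h j))))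
      (n := Function.update μ i (μ i + 1) j) (by simpa using (hle j).2)
    exact ⟨F, hF⟩
  choose M hM using hex
  have hbi : ∀ x, H.stateOf M x = .B → D.IsBichord (H.stateOf M) x := by
    intro x hx
    rcases H.step_or_B x with ⟨j, a, rfl⟩ | hxB
    · have ha := (H.stateOf_step M j a).1 hx
      -- The lower bound 2 in admissibility gives each red step a second red step in its ladder,
      -- hence the bichord property.
      have h1 : 1 < (M j).card := by rw [hM]; exact (hle j).1
      obtain ⟨c, hc, hca⟩ := Finset.exists_mem_ne h1 a
      exact H.isBichord_of_two_red hca.symm hx ((H.stateOf_step M j c).2 hc)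
    · exact isBichord_stateOf hp (hb x hxB) M
  obtain ⟨W, hW⟩ := hmem
  have hzero := oneMinusParity_d hbi W
  rw [hW, map_sub, oneMinusParity_V, oneMinusParity_V, sub_eq_zero, funext hM] at hzero
  -- Raising different coordinates of μ gives different tuples, so exactly one term of V(μ) is seen
  -- over this state.
  rw [Finset.sum_eq_single_of_mem i (by simp [he, hlt]), if_pos rfl] at hzero
  · obtain ⟨i', hi', hne'⟩ := Finset.exists_ne_zero_of_sum_ne_zero (hzero ▸ one_ne_zero)
    refine ⟨i', (Finset.mem_filter.1 hi').2.1, ?_⟩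
    by_contra hcon
    exact hne' (if_neg hcon)
  · intro j _ hji
    refine if_neg fun hcon => ?_
    have := congrFun hcon i
    simp [hji.symm] at this

/-! ### Moving the negative circle -/

/-- The sum of all states with `η j` red steps in the `j`-th ladder and a negative circle
through `p`, where `p` is first moved to an extreme if it lies in a ladder. -/
noncomputable def pointChain (H : LadderSystem D s₀ h) (η : Fin k → ℕ) (p : D.Pt) : D.Chain :=
  ∑ M ∈ stepSets h η, minusState (H.stateOf M) (H.collapse p)

section Moves

variable {η : Fin k → ℕ}

theorem exists_red_of_mem_stepSets (hη : ∀ i, 1 ≤ η i) {M : (i : Fin k) → Finset (Fin (h i))}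
    (hM : M ∈ stepSets h η) (i : Fin k) : ∃ a, H.stateOf M (H.step i a) = .B := by
  have hpos : (M i).Nonempty := by
    rw [← Finset.card_pos, mem_stepSets.1 hM i]
    exact hη i
  obtain ⟨a, ha⟩ := hpos
  exact ⟨a, (H.stateOf_step M i a).2 ha⟩

theorem pointChain_congr (hη : ∀ i, 1 ≤ η i) {p q : D.Pt}
    (hpq : D.circleSetoid H.brokenState p q) : H.pointChain η p = H.pointChain η q :=
  Finset.sum_congr rfl fun M hM => minusState_congr <| H.collapse_related
    (fun _ hx => H.stateOf_of_B M hx) (exists_red_of_mem_stepSets hη hM) hpq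

theorem pointChain_step (hp : ∀ i, H.peripheryNumber i = 1) (hη : ∀ i, 1 ≤ η i) (i : Fin k)
    (a : Fin (h i)) (e : Fin 4) :
    H.pointChain η (Sum.inl (H.step i a, e)) = H.minusChain η i := by
  rw [minusChain_eq, H.eq_stepEnd]
  exact Finset.sum_congr rfl fun M hM => minusState_congr <| H.collapse_stepPt_outerPt (hp i)
    (fun _ hx => H.stateOf_of_B M hx) (exists_red_of_mem_stepSets hη hM) a _

/-- All steps precede `x`, so the sign sees only how many are red, not which. The common sign can
then be factored out of a sum over `M`. -/
theorem changeSign_rest (η : Fin k → ℕ) {x : Fin D.n} (hx : s₀ x = .B) :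
    ∃ c : ℤ, IsUnit c ∧ ∀ M ∈ stepSets h η,
      changeSign (Function.update (H.stateOf M) x .A) x = c := by
  refine ⟨(-1) ^ (∑ j, η j + (Finset.univ.filter fun y => s₀ y = .B ∧ y < x).card),
    (isUnit_neg_one).pow _, fun M hM => ?_⟩
  unfold changeSign
  congr 1
  rw [Finset.card_filter, H.sum_crossings]
  congr 1
  · refine Finset.sum_congr rfl fun j _ => ?_
    rw [← mem_stepSets.1 hM j, ← Finset.card_filter]
    congr 1
    ext b
    simp [H.order_rest x hx j b, Function.update_of_ne (H.ne_step_of_B hx j b), H.stateOf_step]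
  · rw [Finset.card_filter, Finset.sum_filter]
    refine Finset.sum_congr rfl fun y _ => ?_
    by_cases hy : s₀ y = .B
    · rw [if_pos hy]
      congr 1
      refine propext ⟨fun h => ⟨hy, h.1⟩, fun h => ⟨h.2, ?_⟩⟩
      rw [Function.update_of_ne h.2.ne, H.stateOf_of_B M hy]
    · rw [if_neg hy, if_neg fun h => hy h.1]

/-- The negative circle may be moved across a red scar, up to a sign. -/
theorem pointChain_add_mem_range (hp : ∀ i, H.peripheryNumber i = 1) (hη : ∀ i, 1 ≤ η i)
    (hodd : ∀ i, Odd (η i) ∨ h i ≤ η i) {x : Fin D.n} (hx : s₀ x = .B)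
    (hb : D.IsBichord H.brokenState x) :
    H.pointChain η (Sum.inl (x, 1)) + H.pointChain η (Sum.inl (x, 3)) ∈ LinearMap.range D.d := by
  have hd := (isFamily_update hp hx hb).d_sum
    (fun M => ⟨Function.update (H.stateOf M) x .A, fun _ => 1⟩) (fun _ => rfl)
    minusState (fun _ _ _ => minusState_congr) (fun M x hx hb => adjacentSum_plus hx hb) hη
  rw [Finset.sum_eq_zero (s := Finset.univ), zero_add] at hd
  · obtain ⟨c, hc, hc'⟩ := changeSign_rest (H := H) η hx
    have hsum : ∀ M ∈ stepSets h η, ∑ y ∈ Finset.univ.filter (fun y => s₀ y = .B),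
        changeSign (Function.update (H.stateOf M) x .A) y •
          adjacentSum y (⟨Function.update (H.stateOf M) x .A, fun _ => 1⟩ : D.EState) =
        c • (minusState (H.stateOf M) (H.collapse (Sum.inl (x, 1))) +
          minusState (H.stateOf M) (H.collapse (Sum.inl (x, 3)))) := by
      intro M hM
      -- Off the ladders only `x` is blue, so it is the only such crossing that can change.
      rw [Finset.sum_eq_single_of_mem x (by simp [hx])]
      · have hb' := isBichord_stateOf hp hb M
        rw [← update_update_stateOf hx M] at hb'
        rw [hc' M hM, adjacentSum_plus (by simp) hb', update_update_stateOf hx M,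
          H.collapse_of_B hx, H.collapse_of_B hx]
      · intro y hy hyx
        rw [adjacentSum_of_B, smul_zero]
        simp [hyx, H.stateOf_of_B M (Finset.mem_filter.1 hy).2]
    rw [Finset.sum_congr rfl hsum, ← Finset.smul_sum, Finset.sum_add_distrib] at hd
    rcases Int.isUnit_iff.1 hc with rfl | rfl
    · rw [one_smul] at hd
      exact ⟨_, hd⟩
    · rw [neg_smul, one_smul] at hd
      exact (Submodule.neg_mem_iff _).1 ⟨_, hd⟩
  -- The ladder terms vanish: an odd η t kills the coefficient 1 + (-1)^(η t), a full ladder leaves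
  -- no state.
  · intro t _
    rcases hodd t with ho | hle
    · rw [ho.neg_one_pow]
      simp
    · rw [stepSets_eq_empty (i := t), Finset.sum_empty, smul_zero]
      simp only [Function.update_self]
      omega

/-- In a connected component of the diagram the negative circle may be moved freely, up to a
sign. -/
theorem pointChain_of_component (hp : ∀ i, H.peripheryNumber i = 1)
    (hb : ∀ x, s₀ x = .B → D.IsBichord H.brokenState x) (hη : ∀ i, 1 ≤ η i)
    (hodd : ∀ i, Odd (η i) ∨ h i ≤ η i) {a b : CrossingEnd D.n}
    (hab : diagramComponentSetoid D.edge a b) :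
    (LinearMap.range D.d).mkQ (H.pointChain η (Sum.inl a)) =
      (LinearMap.range D.d).mkQ (H.pointChain η (Sum.inl b)) ∨
    (LinearMap.range D.d).mkQ (H.pointChain η (Sum.inl a)) =
      -(LinearMap.range D.d).mkQ (H.pointChain η (Sum.inl b)) := by
  induction hab with
  | refl a => exact Or.inl rfl
  | symm a b _ ih =>
    rcases ih with h1 | h1
    · exact Or.inl h1.symm
    · exact Or.inr (by rw [h1, neg_neg])
  | trans a b c _ _ ih1 ih2 =>
    rcases ih1 with h1 | h1 <;> rcases ih2 with h2 | h2 <;> rw [h1, h2] <;> simp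
  | rel a b hab =>
    rcases hab with rfl | hab
    · exact Or.inl (congrArg _ (pointChain_congr hη (circleSetoid_edge _ a)))
    · obtain ⟨x, e⟩ := a
      obtain ⟨y, e'⟩ := b
      obtain rfl : y = x := hab
      -- At a ladder crossing all ends give the same chain. At a red crossing off the ladders, ends
      -- on one side of the scar agree and crossing the scar changes the sign.
      rcases H.step_or_B y with ⟨i, a, rfl⟩ | hy
      · rw [pointChain_step hp hη, pointChain_step hp hη]
        exact Or.inl rfl
      · have hmem := pointChain_add_mem_range hp hη hodd hy (hb y hy)
        have hneg := (Submodule.Quotient.mk_eq_zero (LinearMap.range D.d)).2 hmem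
        have hneg' : (LinearMap.range D.d).mkQ (H.pointChain η (Sum.inl (y, 1))) =
            -(LinearMap.range D.d).mkQ (H.pointChain η (Sum.inl (y, 3))) :=
          eq_neg_of_add_eq_zero_left hneg
        have hred := H.brokenState_of_B hy
        have key : ∀ e : Fin 4,
            H.pointChain η (Sum.inl (y, e)) = H.pointChain η (Sum.inl (y, 1)) ∨
            H.pointChain η (Sum.inl (y, e)) = H.pointChain η (Sum.inl (y, 3)) := by
          intro e
          have h1 := circleSetoid_smooth H.brokenState (y, e)
          rw [smooth_of_B hred] at h1
          have h2 := pointChain_congr hη h1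
          fin_cases e
          exacts [Or.inr h2, Or.inl rfl, Or.inl h2, Or.inr rfl]
        rcases key e with h1 | h1 <;> rcases key e' with h2 | h2 <;> rw [h1, h2]
        · exact Or.inl rfl
        · exact Or.inr hneg'
        · exact Or.inr (by rw [hneg', neg_neg])
        · exact Or.inl rfl

end Moves

/-- With a single even, non-maximal coordinate the sum defining V(μ) has one term. This is the
situation of both members of an exceptional pair. -/
theorem V_eq_of_unique {μ : Fin k → ℕ} {t : Fin k} (ht : Even (μ t) ∧ μ t < h t)
    (huniq : ∀ i, i ≠ t → ¬ (Even (μ i) ∧ μ i < h i)) :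
    H.V μ = H.minusChain (Function.update μ t (μ t + 1)) t ∨
    H.V μ = -H.minusChain (Function.update μ t (μ t + 1)) t := by
  have : H.V μ = (-1 : ℤ) ^ (∑ j ∈ Finset.univ.filter (fun j => j < t), μ j) •
      H.minusChain (Function.update μ t (μ t + 1)) t := by
    unfold V
    refine Finset.sum_eq_single_of_mem t (by simp [ht]) fun i hi hit => ?_
    exact absurd (Finset.mem_filter.1 hi).2 (huniq i hit)
  rcases neg_one_pow_eq_or ℤ (∑ j ∈ Finset.univ.filter (fun j => j < t), μ j) with hc | hc
  · left; rw [this, hc, one_smul]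
  · right; rw [this, hc, neg_smul, one_smul]

/-- Both cycles reduce to chains with the same η, every entry of which is odd or maximal, and they
differ only in the position of the negative circle. Moving it identifies the classes up to sign. -/
theorem sub_mem_range_of_exceptionalPair (hp : ∀ i, H.peripheryNumber i = 1)
    (hb : ∀ x, s₀ x = .B → D.IsBichord H.brokenState x) {μ μ' : Fin k → ℕ}
    (hμ : AdmissibleTuple h μ)
    (hcomp : ∀ i j, μ i ≠ μ' i → μ j ≠ μ' j → H.SameComponent i j)
    (hex : ExceptionalPair h μ μ') : H.V μ - H.V μ' ∈ LinearMap.range D.d := by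
  obtain ⟨-, t₁, t₂, ⟨hne1, hne2, heq⟩, hodd, he1, hlt1, ho2, h1, h2⟩ := hex
  have h12 : t₁ ≠ t₂ := by
    rintro rfl
    exact Nat.not_even_iff_odd.2 ho2 he1
  have hpos2 : 2 ≤ μ t₂ := (hμ.1 t₂).1
  have hη : Function.update μ t₁ (μ t₁ + 1) = Function.update μ' t₂ (μ' t₂ + 1) := by
    funext j
    by_cases hj1 : j = t₁
    · subst hj1
      simp [h12, h1]
    · by_cases hj2 : j = t₂
      · subst hj2
        simp only [Function.update_of_ne hj1, Function.update_self]
        omega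
      · simp [hj1, hj2, heq j hj1 hj2]
  have hV := V_eq_of_unique (H := H) (t := t₁) ⟨he1, hlt1⟩ fun i hi hcon => by
    by_cases hi2 : i = t₂
    · subst hi2
      exact Nat.not_even_iff_odd.2 ho2 hcon.1
    · rcases hodd i hi hi2 with h | h
      · exact Nat.not_even_iff_odd.2 h hcon.1
      · exact hcon.2.ne h
  have he2 : Even (μ' t₂) := by
    rw [h2]
    exact Nat.Odd.sub_odd ho2 odd_one
  have hlt2 : μ' t₂ < h t₂ := by
    have := (hμ.1 t₂).2
    omega
  have hV' := V_eq_of_unique (H := H) (t := t₂) ⟨he2, hlt2⟩ fun i hi hcon => by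
    by_cases hi1 : i = t₁
    · subst hi1
      rw [h1] at hcon
      exact Nat.not_even_iff_odd.2 he1.add_one hcon.1
    · rw [← heq i hi1 hi] at hcon
      rcases hodd i hi1 hi with h | h
      · exact Nat.not_even_iff_odd.2 h hcon.1
      · exact hcon.2.ne h
  rw [← hη] at hV'
  set η := Function.update μ t₁ (μ t₁ + 1) with hηdef
  have hη1 : ∀ i, 1 ≤ η i := by
    intro i
    by_cases hi : i = t₁
    · subst hi; simp [hηdef]
    · have := (hμ.1 i).1
      simp only [hηdef, Function.update_of_ne hi]
      omega
  have hηodd : ∀ i, Odd (η i) ∨ h i ≤ η i := by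
    intro i
    by_cases hi : i = t₁
    · subst hi
      left
      simpa [hηdef] using he1.add_one
    · simp only [hηdef, Function.update_of_ne hi]
      by_cases hi2 : i = t₂
      · subst hi2
        exact Or.inl ho2
      · exact (hodd i hi hi2).imp_right fun h => h.ge
  -- The unknown sign from moving the circle is irrelevant, since 2V(μ) is the boundary of the
  -- all-positive sum.
  have htwo : (LinearMap.range D.d).mkQ (H.V μ) = -(LinearMap.range D.d).mkQ (H.V μ) := by
    rw [eq_neg_iff_add_eq_zero, ← two_smul ℤ, ← map_smul]
    refine (Submodule.Quotient.mk_eq_zero _).2 ⟨_, d_plusState_eq_two_smul_V hp fun i => ?_⟩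
    have := hμ.1 i
    omega
  have hmove := pointChain_of_component hp hb hη1 hηodd (hcomp t₁ t₂ hne1 hne2)
  unfold first at hmove
  rw [pointChain_step hp hη1, pointChain_step hp hη1] at hmove
  refine (Submodule.Quotient.eq _).1 ?_
  change (LinearMap.range D.d).mkQ (H.V μ) = (LinearMap.range D.d).mkQ (H.V μ')
  have hpm : (LinearMap.range D.d).mkQ (H.V μ) = (LinearMap.range D.d).mkQ (H.V μ') ∨
      (LinearMap.range D.d).mkQ (H.V μ) = -(LinearMap.range D.d).mkQ (H.V μ') := by
    rcases hV with hV | hV <;> rcases hV' with hV' | hV' <;> rcases hmove with hm | hm <;>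
      rw [hV, hV'] <;> simp only [map_neg, hm, neg_neg, true_or, or_true]
  rcases hpm with h | h
  · exact h
  · rw [htwo, h, neg_neg]

end LadderSystem

end LinkDiagram

/-! ### The theorem -/

theorem theorem6p1 (D : LinkDiagram) (s₀ : D.KState) (k : ℕ) (h : Fin k → ℕ)
    (H : D.LadderSystem s₀ h)
    (h_two : ∀ i, 2 ≤ h i)
    (h_periphery : ∀ i, H.peripheryNumber i = 1)
    (h_three : ∃ l, 3 ≤ h l)
    (h_bichord : ∀ x, s₀ x = SmoothingLabel.B → D.IsBichord H.brokenState x)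
    (μ μ' : Fin k → ℕ) (hμ : AdmissibleTuple h μ) (hμ' : AdmissibleTuple h μ')
    (hne : μ ≠ μ') :
    ∃ (hV : H.V μ ∈ LinearMap.ker D.d) (hV' : H.V μ' ∈ LinearMap.ker D.d),
      (D.homologyClass (H.V μ) hV = D.homologyClass (H.V μ') hV' → ExceptionalPair h μ μ') ∧
      ((∀ i j, μ i ≠ μ' i → μ j ≠ μ' j → H.SameComponent i j) → ExceptionalPair h μ μ' →
        D.homologyClass (H.V μ) hV = D.homologyClass (H.V μ') hV') := by
  have hker : ∀ {ν : Fin k → ℕ}, AdmissibleTuple h ν → H.V ν ∈ LinearMap.ker D.d := fun hν =>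
    LinkDiagram.LadderSystem.V_mem_ker h_periphery fun i =>
      ⟨one_le_two.trans (hν.1 i).1, (hν.1 i).2⟩
  refine ⟨hker hμ, hker hμ', fun heq => ?_, fun hcomp hex => ?_⟩
  · exact LinkDiagram.LadderSystem.exceptionalPair_of_sub_mem_range h_periphery h_bichord hμ hne
      ((LinkDiagram.homologyClass_eq_iff _ _).1 heq)
  · exact (LinkDiagram.homologyClass_eq_iff _ _).2
      (LinkDiagram.LadderSystem.sub_mem_range_of_exceptionalPair h_periphery h_bichord hμ
        hcomp hex)
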